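/- Let $m\ge 2$ and $n\ge 3$ be integers, let $K$ be a field, and let $G$ be a connected simple graph on the vertex set $[n]=\{1,\dots,n\}$. Let $R=K[x_{ij} : i\in[m],\, j\in[n]]$, and let $J_m(G)\subseteq R$ be the generalized binomial edge ideal of $G$, that is, the ideal generated by the $2$-minors $x_{ki}x_{lj}-x_{kj}x_{li}$ with $1\le k<l\le m$ and $\{i,j\}$ an edge of $G$ with $i<j$. Call $J_m(G)$ an almost complete intersection if $\mu(J_m(G))=\mathrm{ht}(J_m(G))+1$, where $\mu$ denotes the minimal number of generators and $\mathrm{ht}$ the height. Then $J_m(G)$ is an almost complete intersection if and only if $m=2$ and one of the following holds: 1. $G$ is a tree which is not a path, and $G$ is obtained by adding an edge between two vertices of two disjoint paths, one vertex in each (a single vertex counts as a path); 2. $G$ is not a tree, and $G$ is obtained either by adding an edge between two distinct non-adjacent vertices of a path, or by attaching a path of length at least one to each vertex of a triangle (the three attached paths being disjoint, and each meeting the triangle exactly in one of its own end vertices). In particular, $J_m(G)$ is never an almost complete intersection for $m\ge 3$. -/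

import Mathlib

noncomputable section

/-- The generalized binomial edge ideal `J_m(G)` in `K[x_{ij} : i ∈ [m], j ∈ [n]]`: it is generated
by the 2-minors `x_{ki} x_{lj} - x_{kj} x_{li}` with rows `k < l` and columns `i < j` such that
`{i, j}` is an edge of `G`. The variable `x_{ij}` is `X (i, j)`. -/
def genBinomialEdgeIdeal (K : Type*) [Field K] (m : ℕ) {n : ℕ} (G : SimpleGraph (Fin n)) :
    Ideal (MvPolynomial (Fin m × Fin n) K) :=
  Ideal.span {f | ∃ (k l : Fin m) (i j : Fin n), k < l ∧ i < j ∧ G.Adj i j ∧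
    f = MvPolynomial.X (k, i) * MvPolynomial.X (l, j) -
        MvPolynomial.X (k, j) * MvPolynomial.X (l, i)}

/-- `I` is an almost complete intersection: `μ(I) = ht(I) + 1`, where `μ(I)` is the minimal number
of generators of `I` (which is finite, the ring being Noetherian). -/
def IsAlmostCompleteIntersection {R : Type*} [CommRing R] [IsNoetherianRing R] (I : Ideal R) :
    Prop :=
  (Submodule.spanFinrank I : ℕ∞) = I.height + 1

/-- `G` is a path (on some number of vertices). -/
def IsPathGraph {V : Type*} (G : SimpleGraph V) : Prop :=
  ∃ a : ℕ, Nonempty (G ≃g SimpleGraph.pathGraph a)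

/-- `G` is obtained from two disjoint paths (possibly with a single vertex) by adding an edge
between a vertex of the first and a vertex of the second. -/
def IsTwoPathsPlusEdge {V : Type*} (G : SimpleGraph V) : Prop :=
  ∃ (a b : ℕ) (u : Fin a) (v : Fin b),
    Nonempty (G ≃g (SimpleGraph.pathGraph a ⊕g SimpleGraph.pathGraph b) ⊔
      SimpleGraph.edge (Sum.inl u) (Sum.inr v))

/-- `G` is obtained from a path by adding an edge between two of its (distinct, non-adjacent)
vertices. -/
def IsPathPlusEdge {V : Type*} (G : SimpleGraph V) : Prop :=
  ∃ (a : ℕ) (u v : Fin a), u ≠ v ∧ ¬ (SimpleGraph.pathGraph a).Adj u v ∧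
    Nonempty (G ≃g SimpleGraph.pathGraph a ⊔ SimpleGraph.edge u v)

/-- The triangle with vertices `⟨i, 0⟩`, `i : Fin 3`, where at the vertex `⟨i, 0⟩` a path
`⟨i, 0⟩, ⟨i, 1⟩, …, ⟨i, ℓ i⟩` of length `ℓ i` is attached. -/
def triangleWithPaths (ℓ : Fin 3 → ℕ) : SimpleGraph (Σ i : Fin 3, Fin (ℓ i + 1)) where
  Adj x y :=
    (x.1 = y.1 ∧ ((x.2 : ℕ) + 1 = (y.2 : ℕ) ∨ (y.2 : ℕ) + 1 = (x.2 : ℕ))) ∨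
    (x.1 ≠ y.1 ∧ (x.2 : ℕ) = 0 ∧ (y.2 : ℕ) = 0)
  symm := ⟨fun x y h => by
    rcases h with ⟨h1, h2⟩ | ⟨h1, h2, h3⟩
    · exact Or.inl ⟨h1.symm, h2.symm⟩
    · exact Or.inr ⟨h1.symm, h3, h2⟩⟩
  loopless := ⟨fun x h => by
    rcases h with ⟨_, h2⟩ | ⟨h1, _⟩
    · omega
    · exact h1 rfl⟩

/-- `G` is obtained by attaching a path, of length at least one, to each vertex of a triangle. -/
def IsTriangleWithPaths {V : Type*} (G : SimpleGraph V) : Prop :=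
  ∃ ℓ : Fin 3 → ℕ, (∀ i, 1 ≤ ℓ i) ∧ Nonempty (G ≃g triangleWithPaths ℓ)

end

/-!
Everything is reduced to two elementary estimates for the height of `J_m(G)`, together with
`μ(J_m(G)) = C(m, 2) * |E(G)|` (`spanFinrank_genBinomialEdgeIdeal`): the 2-minors are linearly
independent quadrics, hence a minimal set of generators.

*Upper bound* (`height_genBinomialEdgeIdeal_le`). Let `S` be a set of vertices and `F` a graph off
`S` that connects the ends of each edge of `G` not meeting `S`. A prime that is minimal over the
ideal generated by `J_m(F)` and the variables in the columns `S`, and that contains no other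
variable, also contains `J_m(G)`, since proportionality of nonzero columns is transitive. Krull's
height theorem gives `ht J_m(G) ≤ m * |S| + C(m, 2) * |E(F)|`.

*Lower bound* (`card_le_height_of_colMinor_mem`). Let `P` be a prime containing minors of
consecutive columns in a sequence of distinct columns. Contract `P` to the polynomial rings in the
first `j` columns and extend back: this is a chain of primes below `P`, and it jumps at least as
often as there are minors. A minor `[j, j + 1]` makes no jump only if column `j` vanishes modulo
`P`, but then column `j` itself has contributed two jumps.

For `m ≥ 3` the upper bound with `S` a vertex of degree at least two is already below `μ - 1`. Let
`m = 2`. A spanning tree gives `ht ≤ n - 1`, so an almost complete intersection has at most `n`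
edges. The upper bounds with `|S| ≤ 2` then show that all degrees are at most three, that vertices
of degree three are pairwise adjacent, and that they lie on every cycle. Deleting one suitable edge,
or two edges of a triangle, leaves only paths, by `isPathGraph_of_isTree`, and this identifies `G`.
Conversely, the graphs in question contain linear forests with `n - 2` (for trees) or `n - 1` edges,
to which the lower bound applies; for a triangle with attached paths the sequence of columns has to
be chosen depending on the prime (`le_height_of_isTriangleWithPaths`).
-/

noncomputable section

/-! ### Contractions of a prime to fewer variables, and the lower bound -/

open MvPolynomial

/-- The 2-minor of the generic matrix on rows `k, l` and columns `i, j`. -/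
def colMinor (K : Type*) [Field K] {m n : ℕ} (k l : Fin m) (i j : Fin n) :
    MvPolynomial (Fin m × Fin n) K :=
  X (k, i) * X (l, j) - X (k, j) * X (l, i)

open Classical in
/-- For an ideal `P` of `K[σ]` and a set `s` of variables, the ring homomorphism
`K[σ] → (K[σ] / P)[σ]` which reduces the variables in `s` modulo `P` and keeps the others free. -/
def partialReduction {σ K : Type*} [Field K] (P : Ideal (MvPolynomial σ K)) (s : Set σ) :
    MvPolynomial σ K →+* MvPolynomial σ (MvPolynomial σ K ⧸ P) :=
  eval₂Hom ((C.comp (Ideal.Quotient.mk P)).comp C)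
    fun i => if i ∈ s then C (Ideal.Quotient.mk P (X i)) else X i

/-- The extension to `K[σ]` of the contraction of `P` to `K[s]`, encoded as the kernel of
`partialReduction P s`. -/
def contractExtend {σ K : Type*} [Field K] (P : Ideal (MvPolynomial σ K)) (s : Set σ) :
    Ideal (MvPolynomial σ K) :=
  RingHom.ker (partialReduction P s)

section ContractExtend

variable {σ K : Type*} [Field K] (P : Ideal (MvPolynomial σ K))

instance [P.IsPrime] (s : Set σ) : (contractExtend P s).IsPrime :=
  RingHom.ker_isPrime _

@[simp]
lemma mem_contractExtend {s : Set σ} {f : MvPolynomial σ K} :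
    f ∈ contractExtend P s ↔ partialReduction P s f = 0 := Iff.rfl

lemma partialReduction_X_of_mem {s : Set σ} {i : σ} (h : i ∈ s) :
    partialReduction P s (X i) = C (Ideal.Quotient.mk P (X i)) := by
  simp [partialReduction, h]

lemma partialReduction_X_of_notMem {s : Set σ} {i : σ} (h : i ∉ s) :
    partialReduction P s (X i) = X i := by
  simp [partialReduction, h]

lemma contractExtend_univ : contractExtend P Set.univ = P := by
  have h : partialReduction P Set.univ = C.comp (Ideal.Quotient.mk P) := by
    apply MvPolynomial.ringHom_ext
    · intro r; simp [partialReduction]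
    · intro i; simp [partialReduction_X_of_mem]
  ext f
  rw [mem_contractExtend, h, RingHom.comp_apply, map_eq_zero_iff _ (C_injective _ _),
    Ideal.Quotient.eq_zero_iff_mem]

lemma contractExtend_mono : Monotone (contractExtend P) := by
  classical
  intro s s' hs
  let ψ : MvPolynomial σ (MvPolynomial σ K ⧸ P) →+* MvPolynomial σ (MvPolynomial σ K ⧸ P) :=
    eval₂Hom C fun i => if i ∈ s' then C (Ideal.Quotient.mk P (X i)) else X i
  have h : partialReduction P s' = ψ.comp (partialReduction P s) := by
    apply MvPolynomial.ringHom_ext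
    · intro r; simp [partialReduction, ψ]
    · intro i
      by_cases hi : i ∈ s
      · simp [partialReduction_X_of_mem, hi, hs hi, ψ]
      · simp [partialReduction, ψ, hi]
  intro f hf
  rw [mem_contractExtend] at hf ⊢
  rw [h, RingHom.comp_apply, hf, map_zero]

lemma contractExtend_le (s : Set σ) : contractExtend P s ≤ P := by
  conv_rhs => rw [← contractExtend_univ P]
  exact contractExtend_mono P (Set.subset_univ s)

lemma height_contractExtend_add_one_le [P.IsPrime] {s s' : Set σ} (hs : s ⊆ s')
    {f : MvPolynomial σ K} (hf : f ∉ contractExtend P s) (hf' : f ∈ contractExtend P s') :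
    (contractExtend P s).height + 1 ≤ (contractExtend P s').height :=
  Ideal.height_add_one_le_of_lt_of_isPrime
    (lt_of_le_of_ne (contractExtend_mono P hs) fun h => hf (h ▸ hf'))

/-- Adjoining a variable which lies in `P` increases the height. -/
lemma height_contractExtend_insert [P.IsPrime] {s : Set σ} {i : σ} (hi : i ∉ s) (hP : X i ∈ P) :
    (contractExtend P s).height + 1 ≤ (contractExtend P (insert i s)).height := by
  have : Nontrivial (MvPolynomial σ K ⧸ P) := Ideal.Quotient.nontrivial_iff.2 ‹P.IsPrime›.ne_top
  refine height_contractExtend_add_one_le P (Set.subset_insert i s) (f := X i) ?_ ?_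
  · rw [mem_contractExtend, partialReduction_X_of_notMem P hi]
    exact X_ne_zero i
  · rw [mem_contractExtend, partialReduction_X_of_mem P (Set.mem_insert i s),
      Ideal.Quotient.eq_zero_iff_mem.2 hP, map_zero]

/-- Adjoining both variables of a binomial `aX - bY` of `P`, with `a` and `b` not both in `P`,
increases the height. -/
lemma height_contractExtend_of_binomial [P.IsPrime] {s s' : Set σ} (hs : s ⊆ s') {a b x y : σ}
    (ha : a ∈ s) (hb : b ∈ s) (hx : x ∉ s) (hy : y ∉ s) (hx' : x ∈ s') (hy' : y ∈ s')
    (hxy : x ≠ y) (hab : ¬ ((X a : MvPolynomial σ K) ∈ P ∧ (X b : MvPolynomial σ K) ∈ P))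
    (hP : X a * X x - X y * X b ∈ P) :
    (contractExtend P s).height + 1 ≤ (contractExtend P s').height := by
  classical
  refine height_contractExtend_add_one_le P hs (f := X a * X x - X y * X b) ?_ ?_
  · rw [mem_contractExtend, map_sub, map_mul, map_mul, partialReduction_X_of_mem P ha,
      partialReduction_X_of_mem P hb, partialReduction_X_of_notMem P hx,
      partialReduction_X_of_notMem P hy]
    intro h
    refine hab ⟨?_, ?_⟩
    · have := congrArg (coeff (Finsupp.single x 1)) h
      rw [mul_comm (X y)] at this
      simpa [coeff_C_mul, coeff_X, Finsupp.single_left_inj, hxy, hxy.symm,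
        Ideal.Quotient.eq_zero_iff_mem] using this
    · have := congrArg (coeff (Finsupp.single y 1)) h
      rw [mul_comm (X y)] at this
      simpa [coeff_C_mul, coeff_X, Finsupp.single_left_inj, hxy, hxy.symm,
        Ideal.Quotient.eq_zero_iff_mem] using this
  · rw [mem_contractExtend, map_sub, map_mul, map_mul, partialReduction_X_of_mem P (hs ha),
      partialReduction_X_of_mem P (hs hb), partialReduction_X_of_mem P hx',
      partialReduction_X_of_mem P hy', ← map_mul, ← map_mul, ← map_mul, ← map_mul, ← map_sub,
      ← map_sub, Ideal.Quotient.eq_zero_iff_mem.2 hP, map_zero]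

end ContractExtend

/-- A prime ideal containing the minors `[v j, v (j + 1)]`, `j ∈ A`, of consecutive columns of a
sequence of distinct columns has height at least `|A|`. -/
theorem card_le_height_of_colMinor_mem {K : Type*} [Field K] {m n : ℕ} {k l : Fin m} (hkl : k ≠ l)
    (P : Ideal (MvPolynomial (Fin m × Fin n) K)) [P.IsPrime] (N : ℕ) (v : ℕ → Fin n)
    (hv : Set.InjOn v (Set.Iio N)) (A : Finset ℕ) (hAN : ∀ j ∈ A, j + 1 < N)
    (hA : ∀ j ∈ A, colMinor K k l (v j) (v (j + 1)) ∈ P) :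
    (A.card : ℕ∞) ≤ P.height := by
  classical
  -- the variables in the first `j` columns
  let s : ℕ → Set (Fin m × Fin n) := fun j => {p | ∃ t < j, p.2 = v t}
  have hs : ∀ j, s j ⊆ s (j + 1) := fun j p ⟨t, ht, hp⟩ => ⟨t, by omega, hp⟩
  have hmem : ∀ (i : Fin m) {t j : ℕ}, t < j → (i, v t) ∈ s j := fun i t j h => ⟨t, h, rfl⟩
  have hnot : ∀ (i : Fin m) {j : ℕ}, j < N → (i, v j) ∉ s j := by
    rintro i j hj ⟨t, ht, h⟩
    have := hv (Set.mem_Iio.2 hj) (Set.mem_Iio.2 (ht.trans hj)) h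
    omega
  -- a column that vanishes modulo `P` contributes two to the height, and this pays in advance
  -- for the edge to the next column, which then contributes nothing
  have key : ∀ j ≤ N, (((A.filter (· + 1 < j)).card : ℕ) : ℕ∞) ≤ (contractExtend P (s j)).height ∧
      ∀ t, t + 1 = j → X (k, v t) ∈ P → X (l, v t) ∈ P →
        (((A.filter (· + 1 < j)).card + 1 : ℕ) : ℕ∞) ≤ (contractExtend P (s j)).height := by
    intro j
    induction j with
    | zero => intro _; simp
    | succ j ih =>
      intro hj
      obtain ⟨ih1, ih2⟩ := ih (by omega)
      have hmono : (contractExtend P (s j)).height ≤ (contractExtend P (s (j + 1))).height :=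
        Ideal.height_mono (contractExtend_mono P (hs j))
      have hle : (A.filter (· + 1 < j + 1)).card ≤ (A.filter (· + 1 < j)).card + 1 := by
        have : A.filter (· + 1 < j + 1) ⊆ insert (j - 1) (A.filter (· + 1 < j)) := by
          intro x hx
          simp only [Finset.mem_filter, Finset.mem_insert] at hx ⊢
          by_cases h : x = j - 1
          · exact Or.inl h
          · exact Or.inr ⟨hx.1, by omega⟩
        exact (Finset.card_le_card this).trans (Finset.card_insert_le _ _)
      have two : X (k, v j) ∈ P → X (l, v j) ∈ P →
          (((A.filter (· + 1 < j + 1)).card + 1 : ℕ) : ℕ∞) ≤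
            (contractExtend P (s (j + 1))).height := by
        intro hk hl
        have h1 := height_contractExtend_insert P (hnot k (j := j) (by omega)) hk
        have h2 := height_contractExtend_insert P (s := insert (k, v j) (s j)) (i := (l, v j))
          (by
            rintro (h | h)
            · exact hkl (Prod.ext_iff.1 h).1.symm
            · exact hnot l (by omega) h) hl
        have h3 : insert (l, v j) (insert (k, v j) (s j)) ⊆ s (j + 1) :=
          Set.insert_subset (hmem l (by omega)) (Set.insert_subset (hmem k (by omega)) (hs j))
        have h4 := Ideal.height_mono (contractExtend_mono P h3)
        calc (((A.filter (· + 1 < j + 1)).card + 1 : ℕ) : ℕ∞)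
            ≤ (((A.filter (· + 1 < j)).card + 1 + 1 : ℕ) : ℕ∞) := by exact_mod_cast by omega
          _ = (((A.filter (· + 1 < j)).card : ℕ) : ℕ∞) + 1 + 1 := by push_cast; rfl
          _ ≤ (contractExtend P (s j)).height + 1 + 1 := by gcongr
          _ ≤ _ := ((add_le_add_left h1 1).trans h2).trans h4
      refine ⟨?_, fun t ht hk hl => ?_⟩
      · by_cases hjA : 1 ≤ j ∧ j - 1 ∈ A
        · obtain ⟨t, rfl⟩ : ∃ t, j = t + 1 := ⟨j - 1, by omega⟩
          have htA : t ∈ A := by simpa using hjA.2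
          by_cases hc : X (k, v t) ∈ P ∧ X (l, v t) ∈ P
          · refine le_trans ?_ ((ih2 t rfl hc.1 hc.2).trans hmono)
            exact_mod_cast hle
          · have h1 := height_contractExtend_of_binomial P (hs (t + 1)) (a := (k, v t))
              (b := (l, v t)) (x := (l, v (t + 1))) (y := (k, v (t + 1))) (hmem k (by omega))
              (hmem l (by omega)) (hnot l (by omega)) (hnot k (by omega)) (hmem l (by omega))
              (hmem k (by omega)) (by simp [hkl.symm]) hc (hA t htA)
            calc (((A.filter (· + 1 < t + 1 + 1)).card : ℕ) : ℕ∞)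
                ≤ (((A.filter (· + 1 < t + 1)).card + 1 : ℕ) : ℕ∞) := by exact_mod_cast hle
              _ = (((A.filter (· + 1 < t + 1)).card : ℕ) : ℕ∞) + 1 := by push_cast; rfl
              _ ≤ (contractExtend P (s (t + 1))).height + 1 := by gcongr
              _ ≤ _ := h1
        · have : A.filter (· + 1 < j + 1) = A.filter (· + 1 < j) := by
            ext x
            simp only [Finset.mem_filter]
            refine ⟨fun h => ⟨h.1, ?_⟩, fun h => ⟨h.1, by omega⟩⟩
            by_contra hx
            exact hjA ⟨by omega, by convert h.1 using 1; omega⟩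
          rw [this]
          exact ih1.trans hmono
      · obtain rfl : t = j := by omega
        exact two hk hl
  have h := (key N le_rfl).1
  rw [Finset.filter_true_of_mem hAN] at h
  exact h.trans (Ideal.height_mono (contractExtend_le P _))

/-! ### Minors, generators and the upper bound for the height -/

section Minors

variable {K : Type*} [Field K] {m n : ℕ}

lemma colMinor_swap_rows (k l : Fin m) (i j : Fin n) : colMinor K l k i j = -colMinor K k l i j := by
  unfold colMinor; ring

lemma colMinor_swap_cols (k l : Fin m) (i j : Fin n) : colMinor K k l j i = -colMinor K k l i j := by
  unfold colMinor; ring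

lemma colMinor_self_row (k : Fin m) (i j : Fin n) : colMinor K k k i j = 0 := by
  unfold colMinor; ring

lemma colMinor_self_col (k l : Fin m) (i : Fin n) : colMinor K k l i i = 0 := by
  unfold colMinor; ring

/-- Proportionality of columns is transitive modulo a prime, as long as the middle column does not
vanish. -/
lemma colMinor_mem_trans {P : Ideal (MvPolynomial (Fin m × Fin n) K)} [hP : P.IsPrime]
    {k l : Fin m} {i j h : Fin n} (hj : ¬ (X (k, j) ∈ P ∧ X (l, j) ∈ P))
    (hij : colMinor K k l i j ∈ P) (hjh : colMinor K k l j h ∈ P) : colMinor K k l i h ∈ P := by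
  rw [not_and_or] at hj
  rcases hj with hj | hj
  · refine (hP.mem_or_mem (x := X (k, j)) ?_).resolve_left hj
    have : X (k, j) * colMinor K k l i h =
        X (k, i) * colMinor K k l j h + X (k, h) * colMinor K k l i j := by
      unfold colMinor; ring
    rw [this]
    exact P.add_mem (P.mul_mem_left _ hjh) (P.mul_mem_left _ hij)
  · refine (hP.mem_or_mem (x := X (l, j)) ?_).resolve_left hj
    have : X (l, j) * colMinor K k l i h =
        X (l, i) * colMinor K k l j h + X (l, h) * colMinor K k l i j := by
      unfold colMinor; ring
    rw [this]
    exact P.add_mem (P.mul_mem_left _ hjh) (P.mul_mem_left _ hij)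

lemma colMinor_mem_of_col_mem {P : Ideal (MvPolynomial (Fin m × Fin n) K)}
    {k l : Fin m} {i : Fin n} (hk : X (k, i) ∈ P) (hl : X (l, i) ∈ P) (j : Fin n) :
    colMinor K k l i j ∈ P :=
  P.sub_mem (P.mul_mem_right _ hk) (P.mul_mem_left _ hl)

lemma colMinor_mem_comm {P : Ideal (MvPolynomial (Fin m × Fin n) K)} {k l : Fin m} {i j : Fin n} :
    colMinor K k l i j ∈ P ↔ colMinor K k l j i ∈ P := by
  rw [colMinor_swap_cols, neg_mem_iff]

variable (K m) in
lemma colMinor_mem_genBinomialEdgeIdeal {G : SimpleGraph (Fin n)} (k l : Fin m) {i j : Fin n}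
    (h : G.Adj i j) : colMinor K k l i j ∈ genBinomialEdgeIdeal K m G := by
  have main : ∀ {k l : Fin m} {i j : Fin n}, k < l → i < j → G.Adj i j →
      colMinor K k l i j ∈ genBinomialEdgeIdeal K m G := fun hkl hij h =>
    Ideal.subset_span ⟨_, _, _, _, hkl, hij, h, rfl⟩
  have cols : ∀ {k l : Fin m}, k < l → colMinor K k l i j ∈ genBinomialEdgeIdeal K m G := by
    intro k l hkl
    rcases lt_or_gt_of_ne h.ne with hij | hij
    · exact main hkl hij h
    · exact colMinor_mem_comm.1 (main hkl hij h.symm)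
  rcases lt_trichotomy k l with hkl | rfl | hkl
  · exact cols hkl
  · rw [colMinor_self_row]; exact zero_mem _
  · rw [colMinor_swap_rows, neg_mem_iff]; exact cols hkl

lemma genBinomialEdgeIdeal_le {G : SimpleGraph (Fin n)}
    {P : Ideal (MvPolynomial (Fin m × Fin n) K)}
    (h : ∀ (k l : Fin m) (i j : Fin n), G.Adj i j → colMinor K k l i j ∈ P) :
    genBinomialEdgeIdeal K m G ≤ P := by
  refine Ideal.span_le.2 ?_
  rintro f ⟨k, l, i, j, -, -, hij, rfl⟩
  exact h k l i j hij

end Minors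

section Generators

open Classical in
/-- The edges of `G`, encoded as pairs `(i, j)` with `i < j`. -/
def edgePairs {n : ℕ} (G : SimpleGraph (Fin n)) : Finset (Fin n × Fin n) :=
  Finset.univ.filter fun p => p.1 < p.2 ∧ G.Adj p.1 p.2

lemma mem_edgePairs {n : ℕ} {G : SimpleGraph (Fin n)} {p : Fin n × Fin n} :
    p ∈ edgePairs G ↔ p.1 < p.2 ∧ G.Adj p.1 p.2 := by
  simp [edgePairs]

lemma card_edgePairs {n : ℕ} (G : SimpleGraph (Fin n)) :
    (edgePairs G).card = G.edgeSet.ncard := by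
  classical
  rw [← Set.ncard_coe_finset]
  refine Set.ncard_congr (fun p _ => s(p.1, p.2)) ?_ ?_ ?_
  · intro p hp
    exact (mem_edgePairs.1 hp).2
  · rintro ⟨a, b⟩ ⟨c, d⟩ h1 h2 h
    have h1 := (mem_edgePairs.1 h1).1
    have h2 := (mem_edgePairs.1 h2).1
    rcases Sym2.eq_iff.1 h with ⟨rfl, rfl⟩ | ⟨rfl, rfl⟩
    · rfl
    · exact absurd h1 h2.asymm
  · intro e he
    induction e with
    | h a b =>
      rcases lt_or_gt_of_ne (G.ne_of_adj he) with h | h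
      · exact ⟨(a, b), mem_edgePairs.2 ⟨h, he⟩, rfl⟩
      · exact ⟨(b, a), mem_edgePairs.2 ⟨h, G.adj_symm he⟩, Sym2.eq_swap⟩

/-- The index set of the minimal generators of `J_m(G)`: pairs of rows and edges. -/
def generatorIndex (m : ℕ) {n : ℕ} (G : SimpleGraph (Fin n)) :
    Finset ((Fin m × Fin m) × (Fin n × Fin n)) :=
  edgePairs (⊤ : SimpleGraph (Fin m)) ×ˢ edgePairs G

lemma card_generatorIndex (m : ℕ) {n : ℕ} (G : SimpleGraph (Fin n)) :
    (generatorIndex m G).card = m.choose 2 * G.edgeSet.ncard := by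
  classical
  rw [generatorIndex, Finset.card_product, card_edgePairs, card_edgePairs]
  congr 1
  rw [← SimpleGraph.coe_edgeFinset, Set.ncard_coe_finset,
    SimpleGraph.card_edgeFinset_top_eq_card_choose_two, Fintype.card_fin]

/-- The generator of `J_m(G)` with a given index. -/
def generator (K : Type*) [Field K] {m n : ℕ} (p : (Fin m × Fin m) × (Fin n × Fin n)) :
    MvPolynomial (Fin m × Fin n) K :=
  colMinor K p.1.1 p.1.2 p.2.1 p.2.2

lemma genBinomialEdgeIdeal_eq_span_generator (K : Type*) [Field K] (m : ℕ) {n : ℕ}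
    (G : SimpleGraph (Fin n)) :
    genBinomialEdgeIdeal K m G = Ideal.span (generator K '' (generatorIndex m G : Set _)) := by
  unfold genBinomialEdgeIdeal
  congr 1
  ext f
  constructor
  · rintro ⟨k, l, i, j, hkl, hij, h, rfl⟩
    exact ⟨((k, l), (i, j)), by simp [generatorIndex, mem_edgePairs, hkl, hij, h, hkl.ne], rfl⟩
  · rintro ⟨⟨⟨k, l⟩, ⟨i, j⟩⟩, hp, rfl⟩
    simp only [generatorIndex, Finset.coe_product, Set.mem_prod, Finset.mem_coe,
      mem_edgePairs] at hp
    exact ⟨k, l, i, j, hp.1.1, hp.2.1, hp.2.2, rfl⟩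

end Generators

/-- Krull's height theorem for the ideal generated by the edges of `F` and the columns in `S`,
applied at a minimal prime below the kernel of the evaluation at a `0`-`1` matrix: no column outside
`S` vanishes modulo that prime, so it contains every minor `[i, j]` with `i` and `j` connected
in `F`. -/
theorem height_genBinomialEdgeIdeal_le (K : Type*) [Field K] (m : ℕ) {n : ℕ}
    (G F : SimpleGraph (Fin n)) (S : Finset (Fin n)) (hF : ∀ i j, F.Adj i j → i ∉ S)
    (hG : ∀ i j, G.Adj i j → i ∈ S ∨ j ∈ S ∨ F.Reachable i j) :
    (genBinomialEdgeIdeal K m G).height ≤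
      ((m * S.card + m.choose 2 * F.edgeSet.ncard : ℕ) : ℕ∞) := by
  classical
  let T : Finset (MvPolynomial (Fin m × Fin n) K) :=
    (Finset.univ ×ˢ S).image (fun p => X p) ∪ (generatorIndex m F).image (generator K)
  have hT : T.card ≤ m * S.card + m.choose 2 * F.edgeSet.ncard := by
    refine (Finset.card_union_le _ _).trans (add_le_add ?_ ?_)
    · refine Finset.card_image_le.trans ?_
      simp
    · exact Finset.card_image_le.trans (card_generatorIndex m F).le
  let ev : MvPolynomial (Fin m × Fin n) K →+* K := eval fun p => if p.2 ∈ S then 0 else 1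
  have hTev : Ideal.span (T : Set (MvPolynomial (Fin m × Fin n) K)) ≤ RingHom.ker ev := by
    refine Ideal.span_le.2 fun f hf => ?_
    simp only [T, Finset.coe_union, Finset.coe_image, Set.mem_union, Set.mem_image,
      Finset.mem_coe, Finset.mem_product, Finset.mem_univ, true_and] at hf
    rcases hf with ⟨p, hp, rfl⟩ | ⟨p, hp, rfl⟩
    · simp [ev, hp, RingHom.mem_ker]
    · simp [ev, RingHom.mem_ker, generator, colMinor]
      split_ifs <;> simp
  have : (RingHom.ker ev).IsPrime := RingHom.ker_isPrime _
  obtain ⟨P, hPmin, hPle⟩ := Ideal.exists_minimalPrimes_le hTev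
  have hPprime : P.IsPrime := hPmin.1.1
  have hTP : ∀ f ∈ T, f ∈ P := fun f hf => hPmin.1.2 (Ideal.subset_span hf)
  have hX : ∀ (k : Fin m) (i : Fin n), i ∉ S → X (k, i) ∉ P := by
    intro k i hi h
    have := hPle h
    simp [RingHom.mem_ker, ev, hi] at this
  have hFP : genBinomialEdgeIdeal K m F ≤ P := by
    rw [genBinomialEdgeIdeal_eq_span_generator]
    refine Ideal.span_le.2 ?_
    rintro _ ⟨p, hp, rfl⟩
    exact hTP _ (Finset.mem_union_right _ (Finset.mem_image_of_mem _ hp))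
  have hreach : ∀ (k l : Fin m) (i j : Fin n), F.Reachable i j → colMinor K k l i j ∈ P := by
    rintro k l i j ⟨w⟩
    induction w with
    | nil => rw [colMinor_self_col]; exact zero_mem _
    | @cons i j h hij w ih =>
      exact colMinor_mem_trans (fun h => hX k j (hF _ _ hij.symm) h.1)
        (hFP (colMinor_mem_genBinomialEdgeIdeal K m k l hij)) ih
  have hSP : ∀ (k : Fin m) (i : Fin n), i ∈ S → X (k, i) ∈ P := fun k i hi =>
    hTP _ (Finset.mem_union_left _ (Finset.mem_image_of_mem _ (by simp [hi])))
  have hGP : genBinomialEdgeIdeal K m G ≤ P := by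
    refine genBinomialEdgeIdeal_le fun k l i j hij => ?_
    rcases hG i j hij with hi | hj | h
    · exact colMinor_mem_of_col_mem (hSP k i hi) (hSP l i hi) j
    · exact colMinor_mem_comm.1 (colMinor_mem_of_col_mem (hSP k j hj) (hSP l j hj) i)
    · exact hreach k l i j h
  calc _ ≤ P.height := Ideal.height_mono hGP
    _ ≤ (T.card : ℕ∞) := Ideal.height_le_card_of_mem_minimalPrimes_span_finset hPmin
    _ ≤ _ := by exact_mod_cast hT

/-! ### The minimal number of generators -/

section NumberOfGenerators

variable {K : Type*} [Field K] {m n : ℕ}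

lemma generator_isHomogeneous (p : (Fin m × Fin m) × (Fin n × Fin n)) :
    (generator K p).IsHomogeneous 2 :=
  ((isHomogeneous_X K _).mul (isHomogeneous_X K _)).sub
    ((isHomogeneous_X K _).mul (isHomogeneous_X K _))

/-- The monomial `x_{ki} x_{lj}` occurs in exactly one generator, the one with rows `k < l` and
columns `i < j`. -/
lemma coeff_generator {G : SimpleGraph (Fin n)} {p q : (Fin m × Fin m) × (Fin n × Fin n)}
    (hp : p ∈ generatorIndex m G) (hq : q ∈ generatorIndex m G) :
    coeff (Finsupp.single (p.1.1, p.2.1) 1 + Finsupp.single (p.1.2, p.2.2) 1) (generator K q) =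
      if p = q then 1 else 0 := by
  classical
  obtain ⟨⟨k, l⟩, ⟨i, j⟩⟩ := p
  obtain ⟨⟨k', l'⟩, ⟨i', j'⟩⟩ := q
  simp only [generatorIndex, Finset.mem_product, mem_edgePairs] at hp hq
  have hX : ∀ a b : Fin m × Fin n, (X a * X b : MvPolynomial (Fin m × Fin n) K) =
      monomial (Finsupp.single a 1 + Finsupp.single b 1) 1 := by
    intro a b; simp [X, monomial_mul]
  have hpair : ∀ {a b c d : Fin m × Fin n},
      (Finsupp.single a 1 + Finsupp.single b 1 : (Fin m × Fin n) →₀ ℕ) =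
        Finsupp.single c 1 + Finsupp.single d 1 → (a = c ∧ b = d) ∨ (a = d ∧ b = c) := by
    intro a b c d h
    rcases (Finsupp.single_add_single_eq_single_add_single one_ne_zero one_ne_zero).1 h with
      h | ⟨-, h⟩ | ⟨h, -⟩
    · exact Or.inl h
    · exact Or.inr h
    · omega
  simp only [generator, colMinor, coeff_sub, hX, coeff_monomial]
  have hne : ¬ ((Finsupp.single (k', j') 1 + Finsupp.single (l', i') 1 : (Fin m × Fin n) →₀ ℕ) =
      Finsupp.single (k, i) 1 + Finsupp.single (l, j) 1) := by
    intro h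
    rcases hpair h with ⟨h1, h2⟩ | ⟨h1, h2⟩ <;> simp only [Prod.mk.injEq] at h1 h2 <;> omega
  rw [if_neg hne, sub_zero]
  refine if_congr ⟨fun h => ?_, fun h => ?_⟩ rfl rfl
  · rcases hpair h with ⟨h1, h2⟩ | ⟨h1, h2⟩ <;> simp only [Prod.mk.injEq] at h1 h2
    · obtain ⟨rfl, rfl⟩ := h1
      obtain ⟨rfl, rfl⟩ := h2
      rfl
    · omega
  · simp only [Prod.mk.injEq] at h
    obtain ⟨⟨rfl, rfl⟩, ⟨rfl, rfl⟩⟩ := h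
    rfl

lemma linearIndependent_generator (G : SimpleGraph (Fin n)) :
    LinearIndependent K fun p : generatorIndex m G => generator K p.1 := by
  classical
  rw [Fintype.linearIndependent_iff]
  intro c hc p
  have h := congrArg
    (coeff (Finsupp.single (p.1.1.1, p.1.2.1) 1 + Finsupp.single (p.1.1.2, p.1.2.2) 1)) hc
  rw [coeff_sum] at h
  simpa [coeff_smul, coeff_generator p.2 (Subtype.prop _), Subtype.ext_iff.symm] using h

/-- An ideal generated by quadrics has no elements of degree less than two, so the degree two part
of a multiple `a * f` of an element depends only on the constant coefficient of `a`. -/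
lemma homogeneousComponent_two_mul {σ : Type*} {I : Ideal (MvPolynomial σ K)}
    {s : Set (MvPolynomial σ K)} (hs : ∀ f ∈ s, f.IsHomogeneous 2) (hI : I = Ideal.span s)
    (a : MvPolynomial σ K) {f : MvPolynomial σ K} (hf : f ∈ I) :
    homogeneousComponent 2 (a * f) = coeff 0 a • homogeneousComponent 2 f := by
  have base : ∀ (a : MvPolynomial σ K), ∀ f ∈ s, homogeneousComponent 2 (a * f) =
      coeff 0 a • f := by
    intro a f hf
    conv_lhs => rw [← sum_homogeneousComponent a, Finset.sum_mul, map_sum]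
    rw [Finset.sum_eq_single 0]
    · rw [homogeneousComponent_of_mem
        (((homogeneousComponent_isHomogeneous 0 a).mul (hs f hf))), if_pos rfl,
        homogeneousComponent_zero, C_mul']
    · intro i _ hi
      rw [homogeneousComponent_of_mem
        (((homogeneousComponent_isHomogeneous i a).mul (hs f hf))), if_neg (by omega)]
    · simp
  subst hI
  induction hf using Submodule.span_induction generalizing a with
  | mem f hf =>
    rw [base a f hf, homogeneousComponent_of_mem (hs f hf), if_pos rfl]
  | zero => simp
  | add f g _ _ hf hg => rw [mul_add, map_add, map_add, hf, hg, smul_add]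
  | smul b f _ hf =>
    rw [smul_eq_mul, ← mul_assoc, hf, hf, smul_smul]
    congr 1
    simp [← constantCoeff_eq]

/-- Linearly independent quadrics are a minimal set of generators. -/
theorem spanFinrank_eq_card_of_quadrics {σ ι : Type*} [Finite σ] [Fintype ι]
    {q : ι → MvPolynomial σ K} (hq : ∀ i, (q i).IsHomogeneous 2) (hlin : LinearIndependent K q) :
    Submodule.spanFinrank (Ideal.span (Set.range q)) = Fintype.card ι := by
  classical
  apply le_antisymm
  · refine (Submodule.spanFinrank_span_le_ncard_of_finite (Set.finite_range q)).trans ?_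
    rw [← Set.image_univ]
    refine (Set.ncard_image_le Set.finite_univ).trans ?_
    simp
  · obtain ⟨t, ht, hspan⟩ := Submodule.FG.exists_span_finset_card_eq_spanFinrank
      (IsNoetherian.noetherian (Ideal.span (Set.range q)))
    have hs : ∀ f ∈ Set.range q, f.IsHomogeneous 2 := by rintro _ ⟨i, rfl⟩; exact hq i
    have hmem : ∀ f ∈ Ideal.span (Set.range q),
        homogeneousComponent 2 f ∈ Submodule.span K
          (t.image (homogeneousComponent 2) : Set (MvPolynomial σ K)) := by
      intro f hf
      rw [← hspan] at hf
      induction hf using Submodule.span_induction with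
      | mem f hf => exact Submodule.subset_span (by simpa using ⟨f, hf, rfl⟩)
      | zero => simp
      | add f g _ _ hf hg => rw [map_add]; exact add_mem hf hg
      | smul a f hf' hf =>
        rw [smul_eq_mul, homogeneousComponent_two_mul hs rfl a (by rw [← hspan]; exact hf')]
        exact Submodule.smul_mem _ _ hf
    have hle : Set.range q ⊆ Submodule.span K
        (t.image (homogeneousComponent 2) : Set (MvPolynomial σ K)) := by
      rintro _ ⟨i, rfl⟩
      have := hmem (q i) (Ideal.subset_span ⟨i, rfl⟩)
      rwa [homogeneousComponent_of_mem (hq i), if_pos rfl] at this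
    rw [← ht]
    -- the degree two parts of any generating set span all the quadrics
    have hcard := linearIndependent_le_span_aux' q hlin
      (t.image (homogeneousComponent 2) : Set (MvPolynomial σ K)) hle
    rw [← Set.toFinset_card, Finset.toFinset_coe] at hcard
    exact hcard.trans Finset.card_image_le

theorem spanFinrank_genBinomialEdgeIdeal (G : SimpleGraph (Fin n)) :
    Submodule.spanFinrank (genBinomialEdgeIdeal K m G) = m.choose 2 * G.edgeSet.ncard := by
  have h := spanFinrank_eq_card_of_quadrics
    (fun p : generatorIndex m G => generator_isHomogeneous (K := K) p.1)
    (linearIndependent_generator G)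
  rw [Fintype.card_coe, card_generatorIndex] at h
  rw [← h, genBinomialEdgeIdeal_eq_span_generator, Set.image_eq_range]
  rfl

end NumberOfGenerators

/-! ### Trees with small degrees -/

section Paths

variable {V W : Type*} {G : SimpleGraph V}

open SimpleGraph

/-- Three distinct elements do not fit into a set of cardinality at most two. -/
lemma eq_or_eq_of_ncard_le_two {α : Type*} [Finite α] {s : Set α} (hs : s.ncard ≤ 2) {a b c : α}
    (ha : a ∈ s) (hb : b ∈ s) (hc : c ∈ s) (hab : a ≠ b) : c = a ∨ c = b := by
  by_contra! h
  have h3 : ({a, b, c} : Set α).ncard = 3 :=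
    Set.ncard_eq_three.2 ⟨a, b, c, hab, h.1.symm, h.2.symm, rfl⟩
  have hsub : ({a, b, c} : Set α) ⊆ s := by
    rintro x (rfl | rfl | rfl) <;> assumption
  have := Set.ncard_le_ncard hsub s.toFinite
  omega

/-- A finite tree all of whose vertices have degree at most two is a path: a longest path cannot be
left along an edge. -/
theorem isPathGraph_of_isTree [Finite V] (hG : G.IsTree)
    (hdeg : ∀ v, (G.neighborSet v).ncard ≤ 2) : IsPathGraph G := by
  classical
  have := hG.connected.nonempty
  obtain ⟨u, v, p, hp, hmax⟩ := Walk.exists_isPath_forall_isPath_length_le_length G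
  -- an endpoint has no neighbour off the path, by maximality, and none on it but the next vertex
  have hstart : ∀ {u v : V} (p : G.Walk u v), p.IsPath →
      (∀ u' v' (q : G.Walk u' v'), q.IsPath → q.length ≤ p.length) →
      ∀ y, G.Adj u y → p.toSubgraph.Adj u y := by
    intro u v p hp hmax y hy
    have hy' : y ∈ p.support := by
      by_contra h
      have := hmax _ _ (Walk.cons hy.symm p) (hp.cons h)
      simp at this
    have hnil : ¬ p.Nil := by
      intro h
      rw [Walk.nil_iff_support_eq.1 h, List.mem_singleton] at hy'
      exact hy.ne hy'.symm
    rw [hG.isAcyclic.eq_snd_of_adj_start hp hy hy']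
    exact p.toSubgraph_adj_snd hnil
  have hclosed : ∀ x ∈ p.support, ∀ y, G.Adj x y → p.toSubgraph.Adj x y := by
    intro x hx y hxy
    obtain ⟨i, rfl, hi⟩ := Walk.mem_support_iff_exists_getVert.1 hx
    rcases Nat.eq_zero_or_pos i with rfl | hi0
    · rw [Walk.getVert_zero] at hxy ⊢
      exact hstart p hp hmax y hxy
    rcases hi.eq_or_lt with rfl | hi1
    · rw [Walk.getVert_length] at hxy ⊢
      have := hstart p.reverse hp.reverse (by simpa using hmax) y hxy
      rwa [Walk.toSubgraph_reverse] at this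
    obtain ⟨j, rfl⟩ : ∃ j, i = j + 1 := ⟨i - 1, by omega⟩
    have h1 : p.toSubgraph.Adj (p.getVert (j + 1)) (p.getVert j) :=
      (p.toSubgraph_adj_getVert (by omega)).symm
    have h2 : p.toSubgraph.Adj (p.getVert (j + 1)) (p.getVert (j + 2)) :=
      p.toSubgraph_adj_getVert hi1
    have hne : p.getVert j ≠ p.getVert (j + 2) := by
      intro h
      have := hp.getVert_injOn (by simp; omega) (by simp; omega) h
      omega
    rcases eq_or_eq_of_ncard_le_two (hdeg (p.getVert (j + 1))) h1.adj_sub h2.adj_sub hxy hne with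
      rfl | rfl
    · exact h1
    · exact h2
  have hsupp : ∀ x, x ∈ p.support := by
    intro x
    obtain ⟨w⟩ := hG.connected.preconnected x u
    induction w with
    | nil => exact p.start_mem_support
    | cons h w ih =>
      have := hclosed _ (ih p hp hmax hclosed) _ h.symm
      exact p.mem_verts_toSubgraph.1 this.snd_mem
  have htop : p.toSubgraph = ⊤ := by
    ext x y
    · simpa using hsupp x
    · exact ⟨fun h => h.adj_sub, fun h => hclosed x (hsupp x) y h⟩
  refine ⟨p.length + 1, ⟨?_⟩⟩
  have e := hp.pathGraphIsoToSubgraph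
  rw [htop] at e
  exact (e.trans Subgraph.topIso).symm

/-- A vertex of degree at least three in a tree that is not a path. -/
lemma exists_three_le_of_not_isPathGraph [Finite V] (hG : G.IsTree) (hp : ¬ IsPathGraph G) :
    ∃ v, 3 ≤ (G.neighborSet v).ncard := by
  by_contra! h
  exact hp (isPathGraph_of_isTree hG fun v => Nat.le_of_lt_succ (h v))

lemma neighborSet_deleteEdge_left (u v : V) :
    (G.deleteEdges {s(u, v)}).neighborSet u = G.neighborSet u \ {v} := by
  ext x
  simp only [mem_neighborSet, deleteEdges_adj, Set.mem_singleton_iff, Sym2.eq_iff, Set.mem_sdiff]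
  refine and_congr_right fun h => not_congr ⟨?_, fun hx => Or.inl ⟨trivial, hx⟩⟩
  rintro (⟨-, h'⟩ | ⟨rfl, rfl⟩)
  · exact h'
  · rfl

lemma ncard_neighborSet_deleteEdge_left [Finite V] {u v : V} (h : G.Adj u v) :
    ((G.deleteEdges {s(u, v)}).neighborSet u).ncard + 1 = (G.neighborSet u).ncard := by
  rw [neighborSet_deleteEdge_left]
  exact Set.ncard_sdiff_singleton_add_one h (Set.toFinite _)

lemma ncard_neighborSet_deleteEdge_right [Finite V] {u v : V} (h : G.Adj u v) :
    ((G.deleteEdges {s(u, v)}).neighborSet v).ncard + 1 = (G.neighborSet v).ncard := by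
  rw [Sym2.eq_swap]
  exact ncard_neighborSet_deleteEdge_left h.symm

lemma ncard_neighborSet_mono [Finite V] {H : SimpleGraph V} (h : H ≤ G) (v : V) :
    (H.neighborSet v).ncard ≤ (G.neighborSet v).ncard :=
  Set.ncard_le_ncard (fun _ hx => h hx) (Set.toFinite _)

lemma ncard_neighborSet_deleteEdge_of_ne {u v x : V} (hu : x ≠ u) (hv : x ≠ v) :
    ((G.deleteEdges {s(u, v)}).neighborSet x).ncard = (G.neighborSet x).ncard := by
  congr 1
  ext y
  simp only [mem_neighborSet, deleteEdges_adj, Set.mem_singleton_iff, Sym2.eq_iff]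
  tauto

lemma ncard_edgeSet_deleteEdge [Finite V] {u v : V} (h : G.Adj u v) :
    (G.deleteEdges {s(u, v)}).edgeSet.ncard + 1 = G.edgeSet.ncard := by
  rw [edgeSet_deleteEdges]
  exact Set.ncard_sdiff_singleton_add_one h (Set.toFinite _)

/-- Restoring a deleted edge, in terms of an isomorphic copy of the graph without it. -/
def isoSupEdge {H : SimpleGraph W} {u v : V} (h : G.Adj u v)
    (e : G.deleteEdges {s(u, v)} ≃g H) : G ≃g H ⊔ edge (e u) (e v) where
  toEquiv := e.toEquiv
  map_rel_iff' := by
    intro x y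
    change (H ⊔ edge (e u) (e v)).Adj (e x) (e y) ↔ G.Adj x y
    rw [sup_adj, edge_adj, e.map_adj_iff, deleteEdges_adj]
    simp only [Set.mem_singleton_iff, Sym2.eq_iff, e.injective.eq_iff, e.injective.ne_iff]
    constructor
    · rintro (h' | ⟨⟨rfl, rfl⟩ | ⟨rfl, rfl⟩, -⟩)
      exacts [h'.1, h, h.symm]
    · intro h'
      have := h'.ne
      tauto

@[simp]
lemma isoSupEdge_apply {H : SimpleGraph W} {u v : V} (h : G.Adj u v)
    (e : G.deleteEdges {s(u, v)} ≃g H) (x : V) : isoSupEdge h e x = e x := rfl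

/-- Deleting an edge of a tree leaves two paths, one through each end of the edge, as soon as all
degrees are at most two after the deletion. -/
theorem exists_iso_sum_pathGraph [Finite V] (hG : G.IsTree) {u v : V} (huv : G.Adj u v)
    (hdeg : ∀ x, ((G.deleteEdges {s(u, v)}).neighborSet x).ncard ≤ 2) :
    ∃ (a b : ℕ) (e : G.deleteEdges {s(u, v)} ≃g pathGraph a ⊕g pathGraph b) (i : Fin a) (j : Fin b),
      e u = Sum.inl i ∧ e v = Sum.inr j := by
  classical
  set H := G.deleteEdges {s(u, v)} with hH
  have hHG : H ≤ G := deleteEdges_le _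
  have hacyc : H.IsAcyclic := hG.isAcyclic.anti hHG
  have hbridge : ¬ H.Reachable u v :=
    isBridge_iff.1 (isAcyclic_iff_forall_adj_isBridge.1 hG.isAcyclic huv)
  let c := H.connectedComponentMk u
  let d := H.connectedComponentMk v
  have hcd : c ≠ d := fun h => hbridge (ConnectedComponent.eq.1 h)
  have hcover : ∀ x, H.connectedComponentMk x = c ∨ H.connectedComponentMk x = d := by
    intro x
    obtain ⟨w⟩ := hG.connected.preconnected x u
    have : ∀ {x y : V} (w : G.Walk x y), y = u →
        H.connectedComponentMk x = c ∨ H.connectedComponentMk x = d := by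
      intro x y w
      induction w with
      | nil => rintro rfl; exact Or.inl rfl
      | @cons x y z h w ih =>
        intro hz
        by_cases hxy : s(x, y) = s(u, v)
        · rcases Sym2.eq_iff.1 hxy with ⟨rfl, rfl⟩ | ⟨rfl, rfl⟩
          · exact Or.inl rfl
          · exact Or.inr rfl
        · have hadj : H.Adj x y := by
            rw [hH, deleteEdges_adj]; exact ⟨h, hxy⟩
          rw [ConnectedComponent.eq.2 hadj.reachable]
          exact ih hz
    exact this w rfl
  have hpath : ∀ c : H.ConnectedComponent, IsPathGraph c.toSimpleGraph := by
    intro c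
    refine isPathGraph_of_isTree (hacyc.isTree_connectedComponent c) fun x => ?_
    refine le_trans ?_ (hdeg x)
    rw [← Set.ncard_image_of_injective _ Subtype.val_injective]
    refine Set.ncard_le_ncard ?_ (Set.toFinite _)
    rintro _ ⟨y, hy, rfl⟩
    exact hy
  obtain ⟨a, ⟨ea⟩⟩ := hpath c
  obtain ⟨b, ⟨eb⟩⟩ := hpath d
  let f : V → Fin a ⊕ Fin b := fun x =>
    if h : H.connectedComponentMk x = c then Sum.inl (ea ⟨x, h⟩)
    else Sum.inr (eb ⟨x, (hcover x).resolve_left h⟩)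
  have hfc : ∀ x (h : H.connectedComponentMk x = c), f x = Sum.inl (ea ⟨x, h⟩) := fun x h => by
    simp only [f, dif_pos h]
  have hfd : ∀ x (h : H.connectedComponentMk x = d), f x = Sum.inr (eb ⟨x, h⟩) := fun x h => by
    have : H.connectedComponentMk x ≠ c := fun h' => hcd (h'.symm.trans h)
    simp only [f, dif_neg this]
  have hf : Function.Bijective f := by
    constructor
    · intro x y hxy
      rcases hcover x with hx | hx <;> rcases hcover y with hy | hy
      · rw [hfc x hx, hfc y hy] at hxy
        exact congrArg Subtype.val (ea.injective (Sum.inl.inj hxy))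
      · rw [hfc x hx, hfd y hy] at hxy
        exact (Sum.inl_ne_inr hxy).elim
      · rw [hfd x hx, hfc y hy] at hxy
        exact (Sum.inr_ne_inl hxy).elim
      · rw [hfd x hx, hfd y hy] at hxy
        exact congrArg Subtype.val (eb.injective (Sum.inr.inj hxy))
    · rintro (i | j)
      · obtain ⟨⟨x, hx⟩, rfl⟩ := ea.surjective i
        exact ⟨x, hfc x hx⟩
      · obtain ⟨⟨x, hx⟩, rfl⟩ := eb.surjective j
        exact ⟨x, hfd x hx⟩
  refine ⟨a, b, ⟨Equiv.ofBijective f hf, ?_⟩, _, _, hfc u rfl, hfd v rfl⟩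
  intro x y
  change (pathGraph a ⊕g pathGraph b).Adj (f x) (f y) ↔ H.Adj x y
  have hno : ∀ x y, H.connectedComponentMk x = c → H.connectedComponentMk y = d → ¬ H.Adj x y :=
    fun x y hx hy h => hcd (hx.symm.trans ((ConnectedComponent.eq.2 h.reachable).trans hy))
  rcases hcover x with hx | hx <;> rcases hcover y with hy | hy
  · rw [hfc x hx, hfc y hy, sum_adj_inl, ea.map_adj_iff]
    rfl
  · rw [hfc x hx, hfd y hy]
    simpa using hno x y hx hy
  · rw [hfd x hx, hfc y hy]
    simpa using fun h => hno y x hy hx h.symm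
  · rw [hfd x hx, hfd y hy, sum_adj_inr, eb.map_adj_iff]
    rfl

end Paths

/-! ### Classification of the graphs -/

section Classification

variable {V : Type*} {G : SimpleGraph V}

open SimpleGraph

lemma ncard_neighborSet_deleteEdge_le_two [Finite V] (h3 : ∀ x, (G.neighborSet x).ncard ≤ 3)
    {u v : V} (huv : G.Adj u v) (hdeg : ∀ x, x ≠ u → x ≠ v → (G.neighborSet x).ncard ≤ 2) (x : V) :
    ((G.deleteEdges {s(u, v)}).neighborSet x).ncard ≤ 2 := by
  by_cases hu : x = u
  · subst hu
    have := ncard_neighborSet_deleteEdge_left huv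
    have := h3 x
    omega
  by_cases hv : x = v
  · subst hv
    have := ncard_neighborSet_deleteEdge_right huv
    have := h3 x
    omega
  rw [ncard_neighborSet_deleteEdge_of_ne hu hv]
  exact hdeg x hu hv

/-- In a tree the vertices of degree three are pairwise adjacent only if there are at most two of
them; deleting the edge between them, or any edge at the only one, leaves two paths. -/
theorem isTwoPathsPlusEdge_of_isTree [Finite V] (hG : G.IsTree)
    (h3 : ∀ x, (G.neighborSet x).ncard ≤ 3)
    (hadj : ∀ x y, x ≠ y → 3 ≤ (G.neighborSet x).ncard → 3 ≤ (G.neighborSet y).ncard → G.Adj x y)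
    (hp : ¬ IsPathGraph G) : IsTwoPathsPlusEdge G := by
  classical
  obtain ⟨u, hu⟩ := exists_three_le_of_not_isPathGraph hG hp
  obtain ⟨v, huv, hdeg⟩ : ∃ v, G.Adj u v ∧
      ∀ x, x ≠ u → x ≠ v → (G.neighborSet x).ncard ≤ 2 := by
    by_cases h : ∃ w, w ≠ u ∧ 3 ≤ (G.neighborSet w).ncard
    · obtain ⟨w, hwu, hw⟩ := h
      refine ⟨w, hadj u w hwu.symm hu hw, fun x hxu hxw => ?_⟩
      by_contra! hx
      refine hG.isAcyclic.cliqueFree le_rfl {u, w, x} (is3Clique_triple_iff.2 ⟨?_, ?_, ?_⟩)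
      exacts [hadj _ _ hwu.symm hu hw, hadj _ _ hxu.symm hu hx, hadj _ _ hxw.symm hw hx]
    · push Not at h
      obtain ⟨v, hv⟩ := Set.nonempty_of_ncard_ne_zero (s := G.neighborSet u) (by omega)
      exact ⟨v, hv, fun x hxu _ => Nat.le_of_lt_succ (h x hxu)⟩
  obtain ⟨a, b, e, i, j, hi, hj⟩ := exists_iso_sum_pathGraph hG huv
    (ncard_neighborSet_deleteEdge_le_two h3 huv hdeg)
  have e' := isoSupEdge huv e
  rw [hi, hj] at e'
  exact ⟨a, b, i, j, ⟨e'⟩⟩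

lemma isTree_deleteEdge [Finite V] (hG : G.Connected)
    (hcard : G.edgeSet.ncard = Nat.card V) {u v : V} (huv : G.Adj u v)
    (hb : ¬ G.IsBridge s(u, v)) : (G.deleteEdges {s(u, v)}).IsTree := by
  refine isTree_iff_connected_and_card.2 ⟨hG.connected_delete_edge_of_not_isBridge hb, ?_⟩
  rw [Nat.card_coe_set_eq, ncard_edgeSet_deleteEdge huv, hcard]

/-- Deleting an edge of the cycle of a unicyclic graph leaves a path if no degree exceeds two
afterwards. -/
lemma isPathPlusEdge_of_not_isBridge [Finite V] (hG : G.Connected)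
    (hcard : G.edgeSet.ncard = Nat.card V) (h3 : ∀ x, (G.neighborSet x).ncard ≤ 3)
    {u v : V} (huv : G.Adj u v) (hb : ¬ G.IsBridge s(u, v))
    (hdeg : ∀ x, x ≠ u → x ≠ v → (G.neighborSet x).ncard ≤ 2) : IsPathPlusEdge G := by
  obtain ⟨a, ⟨e⟩⟩ := isPathGraph_of_isTree (isTree_deleteEdge hG hcard huv hb)
    (ncard_neighborSet_deleteEdge_le_two h3 huv hdeg)
  refine ⟨a, e u, e v, fun h => huv.ne (e.injective h), ?_, ⟨isoSupEdge huv e⟩⟩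
  rw [e.map_adj_iff]
  simp

/-- Two disjoint paths with `y + 1` and `x + z + 2` vertices, an end of the first being joined to
two consecutive vertices of the second: the triangle with attached paths of lengths `x`, `y`, `z`,
cut open. -/
def triangleModel (x y z : ℕ) : SimpleGraph (Fin (y + 1) ⊕ Fin (x + z + 2)) :=
  (pathGraph (y + 1) ⊕g pathGraph (x + z + 2)) ⊔
    edge (Sum.inl ⟨0, by omega⟩) (Sum.inr ⟨x, by omega⟩) ⊔
    edge (Sum.inl ⟨0, by omega⟩) (Sum.inr ⟨x + 1, by omega⟩)

/-- The paths at the vertices `0` and `2` of the triangle are concatenated, the first reversed. -/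
def triangleModelMap (ℓ : Fin 3 → ℕ) :
    (Σ i : Fin 3, Fin (ℓ i + 1)) → Fin (ℓ 1 + 1) ⊕ Fin (ℓ 0 + ℓ 2 + 2)
  | ⟨0, k⟩ => Sum.inr ⟨ℓ 0 - k, by omega⟩
  | ⟨1, k⟩ => Sum.inl k
  | ⟨2, k⟩ => Sum.inr ⟨ℓ 0 + 1 + k, by omega⟩

lemma triangleModelMap_bijective (ℓ : Fin 3 → ℕ) : Function.Bijective (triangleModelMap ℓ) := by
  rw [Fintype.bijective_iff_injective_and_card]
  constructor
  · rintro ⟨i, k⟩ ⟨j, l⟩ h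
    fin_cases i <;> fin_cases j <;> simp [triangleModelMap, Fin.ext_iff] at h ⊢ <;> omega
  · simp [Fin.sum_univ_three]
    omega

/-- The triangle with attached paths is isomorphic to the model. -/
def triangleModelIso (ℓ : Fin 3 → ℕ) : triangleWithPaths ℓ ≃g triangleModel (ℓ 0) (ℓ 1) (ℓ 2) where
  toEquiv := Equiv.ofBijective _ (triangleModelMap_bijective ℓ)
  map_rel_iff' := by
    rintro ⟨i, k⟩ ⟨j, l⟩
    change (triangleModel _ _ _).Adj (triangleModelMap ℓ ⟨i, k⟩) (triangleModelMap ℓ ⟨j, l⟩) ↔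
      (i = j ∧ ((k : ℕ) + 1 = l ∨ (l : ℕ) + 1 = k)) ∨ (i ≠ j ∧ (k : ℕ) = 0 ∧ (l : ℕ) = 0)
    rw [triangleModel, sup_adj, sup_adj, edge_adj, edge_adj]
    fin_cases i <;> fin_cases j <;>
      simp [triangleModelMap, pathGraph_adj, Fin.ext_iff, -Fin.val_eq_zero_iff] <;> omega

/-- The reflection of a path. -/
def pathGraphRev (a : ℕ) : pathGraph a ≃g pathGraph a where
  toEquiv := Fin.revPerm
  map_rel_iff' := by
    intro x y
    simp only [Fin.revPerm_apply, pathGraph_adj, Fin.val_rev]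
    omega

lemma exists_third_neighbor [Finite V] {a b c : V} (ha : 3 ≤ (G.neighborSet a).ncard) :
    ∃ d, G.Adj a d ∧ d ≠ b ∧ d ≠ c := by
  by_contra! h
  have hsub : G.neighborSet a ⊆ {b, c} := by
    intro d hd
    by_cases hb : d = b
    · exact Or.inl hb
    · exact Or.inr (h d hd hb)
  have h1 := Set.ncard_le_ncard hsub (Set.toFinite _)
  have h2 := Set.ncard_insert_le b {c}
  rw [Set.ncard_singleton] at h2
  omega

/-- Cutting the triangle of a unicyclic graph open along two of its edges leaves two paths, an end
of one having been joined to two consecutive inner vertices of the other. -/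
theorem isTriangleWithPaths_of_triangle [Finite V] (hG : G.Connected)
    (hcard : G.edgeSet.ncard = Nat.card V) (h3 : ∀ x, (G.neighborSet x).ncard ≤ 3)
    {a b c : V} (hab : G.Adj a b) (hac : G.Adj a c) (hbc : G.Adj b c)
    (ha : 3 ≤ (G.neighborSet a).ncard) (hb : 3 ≤ (G.neighborSet b).ncard)
    (hc : 3 ≤ (G.neighborSet c).ncard)
    (hdeg : ∀ x, x ≠ a → x ≠ b → x ≠ c → (G.neighborSet x).ncard ≤ 2) :
    IsTriangleWithPaths G := by
  classical
  set T := G.deleteEdges {s(b, c)} with hT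
  have hTab : T.Adj b a := by
    rw [hT, deleteEdges_adj]
    refine ⟨hab.symm, ?_⟩
    simp [hac.ne, hab.ne]
  have hTac : T.Adj a c := by
    rw [hT, deleteEdges_adj]
    refine ⟨hac, ?_⟩
    simp [hac.ne, hab.ne]
  have hTtree : T.IsTree := by
    refine isTree_deleteEdge hG hcard hbc ?_
    rw [isBridge_iff, not_not]
    exact hTab.reachable.trans hTac.reachable
  have hTb : (T.neighborSet b).ncard + 1 = (G.neighborSet b).ncard :=
    ncard_neighborSet_deleteEdge_left hbc
  have hTc : (T.neighborSet c).ncard + 1 = (G.neighborSet c).ncard :=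
    ncard_neighborSet_deleteEdge_right hbc
  have hTle : T ≤ G := deleteEdges_le _
  have hT3 : ∀ x, (T.neighborSet x).ncard ≤ 3 := fun x =>
    (ncard_neighborSet_mono hTle x).trans (h3 x)
  have hTdeg : ∀ x, x ≠ b → x ≠ a → (T.neighborSet x).ncard ≤ 2 := by
    intro x hxb hxa
    by_cases hxc : x = c
    · subst hxc
      have := h3 x
      omega
    · exact (ncard_neighborSet_mono hTle x).trans (hdeg x hxa hxb hxc)
  obtain ⟨a', haa', ha'b, ha'c⟩ := exists_third_neighbor (b := b) (c := c) ha
  obtain ⟨b', hbb', hb'a, hb'c⟩ := exists_third_neighbor (b := a) (c := c) hb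
  obtain ⟨c', hcc', hc'a, hc'b⟩ := exists_third_neighbor (b := a) (c := b) hc
  set H := T.deleteEdges {s(b, a)} with hH
  obtain ⟨p, q, e₀, β₀, α₀, hβ₀, hα₀⟩ := exists_iso_sum_pathGraph hTtree hTab
    (ncard_neighborSet_deleteEdge_le_two hT3 hTab hTdeg)
  have hHadj : ∀ {x y}, H.Adj x y ↔ G.Adj x y ∧ s(x, y) ≠ s(b, c) ∧ s(x, y) ≠ s(b, a) := by
    intro x y
    rw [hH, hT, deleteEdges_adj, deleteEdges_adj]
    simp [and_assoc]
  have hHac : H.Adj a c := hHadj.2 ⟨hac, by simp [hac.ne, hab.ne, hbc.ne.symm]⟩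
  have hHa : H.Adj a a' := hHadj.2 ⟨haa', by simp [hac.ne, hab.ne, ha'b]⟩
  have hHb : H.Adj b b' := hHadj.2 ⟨hbb', by simp [hb'c, hb'a, hbc.ne, hab.ne.symm]⟩
  have hHc : H.Adj c c' := hHadj.2
    ⟨hcc', by simp [hac.ne.symm, hbc.ne.symm, hc'b]⟩
  have hHb' : ∀ y, H.Adj b y → y = b' := by
    intro y hy
    have h1 : (H.neighborSet b).ncard + 1 = (T.neighborSet b).ncard :=
      ncard_neighborSet_deleteEdge_left hTab
    have h2 : (H.neighborSet b).ncard ≤ 1 := by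
      have := h3 b
      omega
    exact (Set.ncard_le_one (Set.toFinite _)).1 h2 y hy b' hHb
  -- reflecting the paths, the end `b` comes first, and `a` precedes `c`
  obtain ⟨e, β, α, γ, hβ, hα, hγ, hβ0, hαγ⟩ : ∃ (e : H ≃g pathGraph p ⊕g pathGraph q) (β : Fin p)
      (α γ : Fin q), e b = Sum.inl β ∧ e a = Sum.inr α ∧ e c = Sum.inr γ ∧ (β : ℕ) = 0 ∧
        (γ : ℕ) = α + 1 := by
    obtain ⟨f, β, α, hβ, hα, hβ0⟩ : ∃ (e : H ≃g pathGraph p ⊕g pathGraph q) (β : Fin p)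
        (α : Fin q), e b = Sum.inl β ∧ e a = Sum.inr α ∧ (β : ℕ) = 0 := by
      by_cases h0 : (β₀ : ℕ) = 0
      · exact ⟨e₀, β₀, α₀, hβ₀, hα₀, h0⟩
      have hlast : (β₀ : ℕ) + 1 = p := by
        by_contra hne
        have key : ∀ k : Fin p, (β₀ : ℕ) + 1 = k ∨ (k : ℕ) + 1 = β₀ → Sum.inl k = e₀ b' := by
          intro k hk
          obtain ⟨y, hy⟩ := e₀.surjective (Sum.inl k)
          rw [← hHb' y, hy]
          rw [← e₀.map_adj_iff, hβ₀, hy, sum_adj_inl, pathGraph_adj]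
          exact hk
        have h1 := key ⟨β₀ + 1, by omega⟩ (Or.inl rfl)
        have h2 := key ⟨β₀ - 1, by omega⟩ (Or.inr (by simp only; omega))
        have := congrArg Fin.val (Sum.inl.inj (h1.trans h2.symm))
        simp only at this
        omega
      refine ⟨e₀.trans (Iso.sumCongr (pathGraphRev p) (Iso.refl)), β₀.rev, α₀, ?_, ?_, ?_⟩
      · change Iso.sumCongr _ _ (e₀ b) = _
        rw [hβ₀]; rfl
      · change Iso.sumCongr _ _ (e₀ a) = _
        rw [hα₀]; rfl
      · rw [Fin.val_rev]; omega
    have hf := f.map_adj_iff.2 hHac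
    obtain ⟨γ, hγ⟩ : ∃ γ, f c = Sum.inr γ := by
      rw [hα] at hf
      rcases hfc : f c with i | γ
      · rw [hfc] at hf
        simp at hf
      · exact ⟨γ, rfl⟩
    rw [hα, hγ, sum_adj_inr, pathGraph_adj] at hf
    rcases hf with hf | hf
    · exact ⟨f, β, α, γ, hβ, hα, hγ, hβ0, hf.symm⟩
    · refine ⟨f.trans (Iso.sumCongr Iso.refl (pathGraphRev q)), β, α.rev, γ.rev, ?_, ?_, ?_, hβ0, ?_⟩
      · change Iso.sumCongr _ _ (f b) = _
        rw [hβ]; rfl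
      · change Iso.sumCongr _ _ (f a) = _
        rw [hα]; rfl
      · change Iso.sumCongr _ _ (f c) = _
        rw [hγ]; rfl
      · rw [Fin.val_rev, Fin.val_rev]; omega
  have hp : 2 ≤ p := by
    have h := e.map_adj_iff.2 hHb
    rw [hβ] at h
    rcases hb'' : e b' with i | i
    · rw [hb'', sum_adj_inl, pathGraph_adj] at h
      omega
    · rw [hb''] at h
      simp at h
  have hα1 : 1 ≤ (α : ℕ) := by
    have h := e.map_adj_iff.2 hHa
    rw [hα] at h
    rcases ha'' : e a' with i | i
    · rw [ha''] at h
      simp at h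
    · rw [ha'', sum_adj_inr, pathGraph_adj] at h
      have : i ≠ γ := by
        rintro rfl
        exact ha'c (e.injective (ha''.trans hγ.symm))
      have := Fin.val_ne_of_ne this
      omega
  have hγ1 : (γ : ℕ) + 1 < q := by
    have h := e.map_adj_iff.2 hHc
    rw [hγ] at h
    rcases hc'' : e c' with i | i
    · rw [hc''] at h
      simp at h
    · rw [hc'', sum_adj_inr, pathGraph_adj] at h
      have : i ≠ α := by
        rintro rfl
        exact hc'a (e.injective (hc''.trans hα.symm))
      have := Fin.val_ne_of_ne this
      omega
  have E := isoSupEdge hbc (isoSupEdge hTab e)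
  rw [isoSupEdge_apply, isoSupEdge_apply, hβ, hα, hγ] at E
  obtain ⟨y, rfl⟩ : ∃ y, p = y + 1 := ⟨p - 1, by omega⟩
  obtain ⟨x, hx⟩ : ∃ x, x = (α : ℕ) := ⟨_, rfl⟩
  obtain ⟨z, rfl⟩ : ∃ z, q = x + z + 2 := ⟨q - 2 - x, by omega⟩
  have hx0 : x < x + z + 2 := by clear * -; omega
  have hx1 : x + 1 < x + z + 2 := by clear * -; omega
  have hβ' : β = ⟨0, Nat.succ_pos y⟩ := Fin.ext hβ0
  have hα' : α = ⟨x, hx0⟩ := Fin.ext hx.symm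
  have hγ' : γ = ⟨x + 1, hx1⟩ := Fin.ext (hαγ.trans (congrArg (· + 1) hx.symm))
  rw [hβ', hα', hγ'] at E
  refine ⟨![x, y, z], ?_, ⟨E.trans (triangleModelIso ![x, y, z]).symm⟩⟩
  intro i
  fin_cases i <;> simp at * <;> omega

/-- The classification of connected unicyclic graphs with maximal degree at most three, in which the
vertices of degree three are pairwise adjacent and lie on the cycle. -/
theorem isPathPlusEdge_or_isTriangleWithPaths [Finite V] (hG : G.Connected)
    (hcard : G.edgeSet.ncard = Nat.card V) (h3 : ∀ x, (G.neighborSet x).ncard ≤ 3)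
    (hadj : ∀ x y, x ≠ y → 3 ≤ (G.neighborSet x).ncard → 3 ≤ (G.neighborSet y).ncard → G.Adj x y)
    (hcyc : ∀ x, 3 ≤ (G.neighborSet x).ncard → ∀ (y : V) (w : G.Walk y y), w.IsCycle →
      x ∈ w.support) : IsPathPlusEdge G ∨ IsTriangleWithPaths G := by
  classical
  have hnot : ¬ G.IsAcyclic := by
    intro h
    have := (isTree_iff_connected_and_card.1 ⟨hG, h⟩).2
    rw [Nat.card_coe_set_eq] at this
    omega
  unfold IsAcyclic at hnot
  push Not at hnot
  obtain ⟨v₀, c, hc⟩ := hnot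
  have first : ∀ {v : V} (c : G.Walk v v), c.IsCycle → G.Adj v c.snd ∧ ¬ G.IsBridge s(v, c.snd) := by
    intro v c hc
    refine ⟨c.adj_snd hc.not_nil, fun h => h.notMem_edges_of_isCycle hc ?_⟩
    exact c.mk_start_snd_mem_edges hc.not_nil
  by_cases h1 : ∃ u, 3 ≤ (G.neighborSet u).ncard
  swap
  · push Not at h1
    obtain ⟨h, hb⟩ := first c hc
    exact Or.inl (isPathPlusEdge_of_not_isBridge hG hcard h3 h hb
      fun x _ _ => Nat.le_of_lt_succ (h1 x))
  obtain ⟨u, hu⟩ := h1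
  have huc := hcyc u hu _ c hc
  by_cases h2 : ∃ w, w ≠ u ∧ 3 ≤ (G.neighborSet w).ncard
  swap
  · push Not at h2
    obtain ⟨h, hb⟩ := first (c.rotate u huc) (hc.rotate huc)
    exact Or.inl (isPathPlusEdge_of_not_isBridge hG hcard h3 h hb
      fun x hx _ => Nat.le_of_lt_succ (h2 x hx))
  obtain ⟨w, hwu, hw⟩ := h2
  have huw := hadj u w hwu.symm hu hw
  by_cases hx : ∃ x, x ≠ u ∧ x ≠ w ∧ 3 ≤ (G.neighborSet x).ncard
  · obtain ⟨x, hxu, hxw, hx⟩ := hx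
    have hux := hadj u x hxu.symm hu hx
    have hwx := hadj w x hxw.symm hw hx
    refine Or.inr (isTriangleWithPaths_of_triangle hG hcard h3 huw hux hwx hu hw hx ?_)
    intro y hyu hyw hyx
    -- a further vertex of degree three would lie on the triangle
    by_contra! hy
    have ht : (Walk.cons huw (Walk.cons hwx (Walk.cons hux.symm Walk.nil))).IsCycle := by
      simp [Walk.isCycle_def, Walk.isTrail_def, hux.ne, huw.ne, hwx.ne, hwu, hxu]
    have := hcyc y hy _ _ ht
    simp [hyu, hyw, hyx] at this
  · push Not at hx
    refine Or.inl (isPathPlusEdge_of_not_isBridge hG hcard h3 huw ?_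
      fun x hxu hxw => Nat.le_of_lt_succ (hx x hxu hxw))
    -- if the edge `uw` is a bridge, the cycle joins `u` and `w` without using it
    intro hb
    have hwc : w ∈ (c.rotate u huc).support := hcyc w hw _ _ (hc.rotate huc)
    refine isBridge_iff.1 hb (reachable_deleteEdges_iff_exists_walk.2
      ⟨(c.rotate u huc).takeUntil w hwc, fun h => ?_⟩)
    exact hb.notMem_edges_of_isCycle (hc.rotate huc) (Walk.edges_takeUntil_subset_edges _ hwc h)

end Classification

/-! ### Upper bounds for the height in terms of vertex degrees -/

section DeleteVertex

variable {V : Type*} {G : SimpleGraph V}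

open SimpleGraph

/-- The graph `G` with all edges at the vertex `v` deleted. -/
def isolate (G : SimpleGraph V) (v : V) : SimpleGraph V := G.deleteEdges (G.incidenceSet v)

lemma isolate_adj {v x y : V} : (isolate G v).Adj x y ↔ G.Adj x y ∧ x ≠ v ∧ y ≠ v := by
  simp only [isolate, deleteEdges_adj, incidenceSet, Set.mem_sep_iff, mem_edgeSet, Sym2.mem_iff]
  constructor
  · rintro ⟨h, h'⟩
    exact ⟨h, fun hx => h' ⟨h, Or.inl hx.symm⟩, fun hy => h' ⟨h, Or.inr hy.symm⟩⟩
  · rintro ⟨h, hx, hy⟩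
    refine ⟨h, ?_⟩
    rintro ⟨-, h | h⟩
    exacts [hx h.symm, hy h.symm]

lemma ncard_edgeSet_isolate [Finite V] (v : V) :
    (isolate G v).edgeSet.ncard + (G.neighborSet v).ncard = G.edgeSet.ncard := by
  classical
  have h1 : (G.neighborSet v).ncard = (G.incidenceSet v).ncard := by
    rw [← Nat.card_coe_set_eq, ← Nat.card_coe_set_eq]
    exact (Nat.card_congr (G.incidenceSetEquivNeighborSet v)).symm
  rw [h1, isolate, edgeSet_deleteEdges]
  exact Set.ncard_sdiff_add_ncard_of_subset (G.incidenceSet_subset v) (Set.toFinite _)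

lemma neighborSet_isolate_of_not_adj {v w : V} (hvw : v ≠ w) (h : ¬ G.Adj v w) :
    (isolate G v).neighborSet w = G.neighborSet w := by
  ext x
  simp only [mem_neighborSet, isolate_adj]
  refine ⟨fun h => h.1, fun hx => ⟨hx, hvw.symm, ?_⟩⟩
  rintro rfl
  exact h hx.symm

end DeleteVertex

section UpperBounds

variable (K : Type*) [Field K] {n : ℕ} {G : SimpleGraph (Fin n)}

open SimpleGraph

lemma height_le_of_vertex (m : ℕ) (G : SimpleGraph (Fin n)) (v : Fin n) :
    (genBinomialEdgeIdeal K m G).height ≤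
      ((m + m.choose 2 * (isolate G v).edgeSet.ncard : ℕ) : ℕ∞) := by
  have h := height_genBinomialEdgeIdeal_le K m G (isolate G v) {v}
    (fun i j h => by simpa using (isolate_adj.1 h).2.1)
    (fun i j h => by
      by_cases hi : i = v
      · simp [hi]
      by_cases hj : j = v
      · simp [hj]
      exact Or.inr (Or.inr (isolate_adj.2 ⟨h, hi, hj⟩).reachable))
  simpa using h

lemma height_le_of_two_vertices {v w : Fin n} (hvw : v ≠ w) (hnot : ¬ G.Adj v w) :
    (genBinomialEdgeIdeal K 2 G).height + (G.neighborSet v).ncard + (G.neighborSet w).ncard ≤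
      ((4 + G.edgeSet.ncard : ℕ) : ℕ∞) := by
  have h := height_genBinomialEdgeIdeal_le K 2 G (isolate (isolate G v) w) {v, w}
    (fun i j h => by
      have h1 := isolate_adj.1 h
      have h2 := isolate_adj.1 h1.1
      simp [h1.2.1, h2.2.1])
    (fun i j h => by
      by_cases hi : i = v ∨ i = w
      · simp [hi]
      by_cases hj : j = v ∨ j = w
      · simp [hj]
      push Not at hi hj
      exact Or.inr (Or.inr (isolate_adj.2 ⟨isolate_adj.2 ⟨h, hi.1, hj.1⟩, hi.2, hj.2⟩).reachable))
  have h1 := ncard_edgeSet_isolate (G := G) v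
  have h2 := ncard_edgeSet_isolate (G := isolate G v) w
  rw [neighborSet_isolate_of_not_adj hvw hnot] at h2
  rw [Finset.card_pair hvw] at h
  refine (add_le_add_left (add_le_add_left h _) _).trans ?_
  norm_cast
  simp only [Nat.choose_self]
  omega

/-- If a cycle avoids `v`, an edge of it can be omitted without changing the connected components of
`G - v`, which improves the bound obtained by isolating `v` by one. -/
lemma height_le_of_cycle {v x : Fin n} {w : G.Walk x x} (hw : w.IsCycle) (hv : v ∉ w.support) :
    (genBinomialEdgeIdeal K 2 G).height + (G.neighborSet v).ncard ≤
      ((1 + G.edgeSet.ncard : ℕ) : ℕ∞) := by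
  have hedges : ∀ e ∈ w.edges, e ∈ (isolate G v).edgeSet := by
    intro e he
    induction e with
    | h a b =>
      refine isolate_adj.2 ⟨w.adj_of_mem_edges he, ?_, ?_⟩
      · rintro rfl
        exact hv (w.fst_mem_support_of_mem_edges he)
      · rintro rfl
        exact hv (w.snd_mem_support_of_mem_edges he)
  have hx : s(x, w.snd) ∈ w.edges := w.mk_start_snd_mem_edges hw.not_nil
  have hadj : (isolate G v).Adj x w.snd := hedges _ hx
  have hb : ¬ (isolate G v).IsBridge s(x, w.snd) := fun hb =>
    hb.notMem_edges_of_isCycle (hw.transfer hedges) (by rwa [Walk.edges_transfer])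
  rw [isBridge_iff, not_not] at hb
  have h := height_genBinomialEdgeIdeal_le K 2 G ((isolate G v).deleteEdges {s(x, w.snd)}) {v}
    (fun i j h => by simpa using (isolate_adj.1 (deleteEdges_le _ h)).2.1)
    (fun i j h => by
      by_cases hi : i = v
      · simp [hi]
      by_cases hj : j = v
      · simp [hj]
      refine Or.inr (Or.inr ?_)
      by_cases he : s(i, j) = s(x, w.snd)
      · rcases Sym2.eq_iff.1 he with ⟨rfl, rfl⟩ | ⟨rfl, rfl⟩
        exacts [hb, hb.symm]
      · refine Adj.reachable ?_
        rw [deleteEdges_adj]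
        exact ⟨isolate_adj.2 ⟨h, hi, hj⟩, he⟩)
  have h1 := ncard_edgeSet_isolate (G := G) v
  have h2 := ncard_edgeSet_deleteEdge hadj
  refine (add_le_add_left h _).trans ?_
  norm_cast
  simp only [Nat.choose_self, Finset.card_singleton]
  omega

lemma height_le_of_connected (hG : G.Connected) :
    (genBinomialEdgeIdeal K 2 G).height + 1 ≤ (n : ℕ∞) := by
  obtain ⟨T, hTG, hT⟩ := hG.exists_isTree_le
  have h := height_genBinomialEdgeIdeal_le K 2 G T ∅ (by simp)
    (fun i j _ => Or.inr (Or.inr (hT.connected.preconnected i j)))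
  have hcard := (isTree_iff_connected_and_card.1 hT).2
  rw [Nat.card_coe_set_eq, Nat.card_fin] at hcard
  refine (add_le_add_left h _).trans ?_
  norm_cast
  simp only [Nat.choose_self, Finset.card_empty]
  omega

end UpperBounds

/-! ### Lower bounds for the height in terms of spanning paths -/

section LowerBounds

variable (K : Type*) [Field K] {n : ℕ} {G : SimpleGraph (Fin n)}

open SimpleGraph

/-- It suffices to find, for each prime `P` containing `J_2(G)`, a sequence of distinct columns such
that `P` contains many of the minors of consecutive columns. -/
lemma card_le_height_genBinomialEdgeIdeal (N : ℕ) (A : Finset ℕ) (hAN : ∀ j ∈ A, j + 1 < N)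
    (h : ∀ P : Ideal (MvPolynomial (Fin 2 × Fin n) K), P.IsPrime → genBinomialEdgeIdeal K 2 G ≤ P →
      ∃ v : ℕ → Fin n, (∀ s t, s < N → t < N → v s = v t → s = t) ∧
        ∀ j ∈ A, colMinor K 0 1 (v j) (v (j + 1)) ∈ P) :
    (A.card : ℕ∞) ≤ (genBinomialEdgeIdeal K 2 G).height := by
  rw [Ideal.height_eq_inf_minimalPrimes]
  refine le_iInf₂ fun P hP => ?_
  have := hP.1.1
  obtain ⟨v, hv, hA⟩ := h P this hP.1.2
  exact card_le_height_of_colMinor_mem zero_ne_one P N v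
    (fun s hs t ht hst => hv s t hs ht hst) A hAN hA

lemma height_ge_of_path {v : ℕ → Fin n} {N : ℕ} (hv : ∀ s t, s < N → t < N → v s = v t → s = t)
    (A : Finset ℕ) (hA : ∀ j ∈ A, j + 1 < N ∧ G.Adj (v j) (v (j + 1))) :
    (A.card : ℕ∞) ≤ (genBinomialEdgeIdeal K 2 G).height :=
  card_le_height_genBinomialEdgeIdeal K N A (fun j hj => (hA j hj).1) fun _ _ hP =>
    ⟨v, hv, fun j hj => hP (colMinor_mem_genBinomialEdgeIdeal K 2 0 1 (hA j hj).2)⟩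

/-- The vertices of a graph containing a spanning path, listed along it. -/
lemma exists_sequence {a : ℕ} {H : SimpleGraph (Fin a)} (hn : 0 < n) (e : G ≃g H)
    (hH : pathGraph a ≤ H) :
    ∃ v : ℕ → Fin n, (∀ s t, s < a → t < a → v s = v t → s = t) ∧
      ∀ s, s + 1 < a → G.Adj (v s) (v (s + 1)) := by
  refine ⟨fun s => if h : s < a then e.symm ⟨s, h⟩ else ⟨0, hn⟩, ?_, ?_⟩
  · intro s t hs ht h
    simp only [dif_pos hs, dif_pos ht] at h
    exact congrArg Fin.val (e.symm.injective h)
  · intro s hs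
    simp only [dif_pos hs, dif_pos (Nat.lt_of_succ_lt hs)]
    rw [e.symm.map_adj_iff]
    exact hH (pathGraph_adj.2 (Or.inl rfl))

/-- The vertices of a graph containing two disjoint paths that together are spanning, listed along
the paths. -/
lemma exists_two_sequences {a b : ℕ} {H : SimpleGraph (Fin a ⊕ Fin b)} (hn : 0 < n) (e : G ≃g H)
    (hH : pathGraph a ⊕g pathGraph b ≤ H) :
    ∃ p q : ℕ → Fin n, (∀ s t, s < a → t < a → p s = p t → s = t) ∧
      (∀ s t, s < b → t < b → q s = q t → s = t) ∧ (∀ s t, s < a → t < b → p s ≠ q t) ∧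
      (∀ s, s + 1 < a → G.Adj (p s) (p (s + 1))) ∧ (∀ s, s + 1 < b → G.Adj (q s) (q (s + 1))) ∧
      ∀ s t (hs : s < a) (ht : t < b), H.Adj (Sum.inl ⟨s, hs⟩) (Sum.inr ⟨t, ht⟩) →
        G.Adj (p s) (q t) := by
  refine ⟨fun s => if h : s < a then e.symm (Sum.inl ⟨s, h⟩) else ⟨0, hn⟩,
    fun s => if h : s < b then e.symm (Sum.inr ⟨s, h⟩) else ⟨0, hn⟩, ?_, ?_, ?_, ?_, ?_, ?_⟩
  · intro s t hs ht h
    simp only [dif_pos hs, dif_pos ht] at h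
    exact congrArg Fin.val (Sum.inl.inj (e.symm.injective h))
  · intro s t hs ht h
    simp only [dif_pos hs, dif_pos ht] at h
    exact congrArg Fin.val (Sum.inr.inj (e.symm.injective h))
  · intro s t hs ht h
    simp only [dif_pos hs, dif_pos ht] at h
    exact Sum.inl_ne_inr (e.symm.injective h)
  · intro s hs
    simp only [dif_pos hs, dif_pos (Nat.lt_of_succ_lt hs)]
    rw [e.symm.map_adj_iff]
    exact hH (sum_adj_inl.2 (pathGraph_adj.2 (Or.inl rfl)))
  · intro s hs
    simp only [dif_pos hs, dif_pos (Nat.lt_of_succ_lt hs)]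
    rw [e.symm.map_adj_iff]
    exact hH (sum_adj_inr.2 (pathGraph_adj.2 (Or.inl rfl)))
  · intro s t hs ht h
    simp only [dif_pos hs, dif_pos ht]
    rwa [e.symm.map_adj_iff]

lemma le_height_of_spanning_path (hn : 0 < n) {a : ℕ} {H : SimpleGraph (Fin a)} (e : G ≃g H)
    (hH : pathGraph a ≤ H) : ((n - 1 : ℕ) : ℕ∞) ≤ (genBinomialEdgeIdeal K 2 G).height := by
  obtain rfl : n = a := by simpa using Fintype.card_congr e.toEquiv
  obtain ⟨v, hv, hadj⟩ := exists_sequence hn e hH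
  have := height_ge_of_path K hv (Finset.range (n - 1))
    (fun j hj => ⟨by simp at hj; omega, hadj j (by simp at hj; omega)⟩)
  rwa [Finset.card_range] at this

lemma le_height_of_isPathGraph (hn : 0 < n) (h : IsPathGraph G) :
    ((n - 1 : ℕ) : ℕ∞) ≤ (genBinomialEdgeIdeal K 2 G).height := by
  obtain ⟨a, ⟨e⟩⟩ := h
  exact le_height_of_spanning_path K hn e le_rfl

lemma le_height_of_isPathPlusEdge (hn : 0 < n) (h : IsPathPlusEdge G) :
    ((n - 1 : ℕ) : ℕ∞) ≤ (genBinomialEdgeIdeal K 2 G).height := by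
  obtain ⟨a, u, v, -, -, ⟨e⟩⟩ := h
  exact le_height_of_spanning_path K hn e le_sup_left

lemma le_height_of_isTwoPathsPlusEdge (hn : 0 < n) (h : IsTwoPathsPlusEdge G) :
    ((n - 2 : ℕ) : ℕ∞) ≤ (genBinomialEdgeIdeal K 2 G).height := by
  obtain ⟨a, b, u, v, ⟨e⟩⟩ := h
  have hab : n = a + b := by simpa using Fintype.card_congr e.toEquiv
  obtain ⟨p, q, hp, hq, hpq, hpa, hqa, -⟩ := exists_two_sequences hn e le_sup_left
  have ha := u.pos
  have hb := v.pos
  have hv : ∀ s t, s < n → t < n → (if s < a then p s else q (s - a)) =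
      (if t < a then p t else q (t - a)) → s = t := by
    intro s t hs ht h
    split_ifs at h with h1 h2 h2
    · exact hp s t h1 h2 h
    · exact absurd h (hpq s (t - a) h1 (by omega))
    · exact absurd h.symm (hpq t (s - a) h2 (by omega))
    · have := hq (s - a) (t - a) (by omega) (by omega) h
      omega
  have := height_ge_of_path K hv ((Finset.range (n - 1)).erase (a - 1)) (fun j hj => by
    simp only [Finset.mem_erase, Finset.mem_range] at hj
    refine ⟨by omega, ?_⟩
    by_cases h1 : j < a
    · rw [if_pos h1, if_pos (by omega)]
      exact hpa j (by omega)
    · rw [if_neg h1, if_neg (by omega), show j + 1 - a = j - a + 1 by omega]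
      exact hqa _ (by omega))
  rw [Finset.card_erase_of_mem (by simp; omega), Finset.card_range] at this
  exact this

/-- Modulo a prime `P`, the columns of the triangle and of an initial part of one attached path are
proportional, up to the first vertex of that path (if any) whose column vanishes. Hence this initial
part can be inserted into the path formed by the two other attached paths, and the rest, starting
with a vanishing column, can be appended to it. -/
lemma le_height_of_isTriangleWithPaths (hn : 0 < n) (h : IsTriangleWithPaths G) :
    ((n - 1 : ℕ) : ℕ∞) ≤ (genBinomialEdgeIdeal K 2 G).height := by
  classical
  obtain ⟨ℓ, -, ⟨e⟩⟩ := h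
  replace e := e.trans (triangleModelIso ℓ)
  generalize ℓ 0 = x, ℓ 1 = y, ℓ 2 = z at e
  have hcard : n = (y + 1) + (x + z + 2) := by simpa using Fintype.card_congr e.toEquiv
  obtain ⟨p, q, hp, hq, hpq, hpa, hqa, hpqa⟩ :=
    exists_two_sequences hn e (le_sup_left.trans le_sup_left)
  have hpx : G.Adj (p 0) (q x) := hpqa 0 x (by omega) (by omega) (by
    rw [triangleModel, sup_adj, sup_adj, edge_adj]
    simp)
  have hpx1 : G.Adj (p 0) (q (x + 1)) := hpqa 0 (x + 1) (by omega) (by omega) (by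
    rw [triangleModel, sup_adj, sup_adj, edge_adj, edge_adj]
    simp)
  have key := card_le_height_genBinomialEdgeIdeal K (G := G) n (Finset.range (n - 1))
    (fun j hj => by simp at hj; omega) ?_
  · rwa [Finset.card_range] at key
  intro P hP hGP
  have hmem : ∀ {i j : Fin n}, G.Adj i j → colMinor K 0 1 i j ∈ P := fun h =>
    hGP (colMinor_mem_genBinomialEdgeIdeal K 2 0 1 h)
  have hex : ∃ j, j = y + 1 ∨
      (MvPolynomial.X (0, p j) ∈ P ∧ MvPolynomial.X (1, p j) ∈ P) := ⟨y + 1, Or.inl rfl⟩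
  -- `j` is the position of the first vanishing column, or `y + 1` if there is none
  obtain ⟨j, hj, hjmin⟩ : ∃ j, (j = y + 1 ∨
      (MvPolynomial.X (0, p j) ∈ P ∧ MvPolynomial.X (1, p j) ∈ P)) ∧
      ∀ i < j, ¬ (i = y + 1 ∨ (MvPolynomial.X (0, p i) ∈ P ∧ MvPolynomial.X (1, p i) ∈ P)) :=
    ⟨Nat.find hex, Nat.find_spec hex, fun i hi => Nat.find_min hex hi⟩
  have hjy : j ≤ y + 1 := by
    by_contra h
    exact hjmin (y + 1) (by omega) (Or.inl rfl)
  have hprop : ∀ i < j, colMinor K 0 1 (q (x + 1)) (p i) ∈ P := by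
    intro i
    induction i with
    | zero => exact fun _ => hmem hpx1.symm
    | succ i ih =>
      intro hi
      exact colMinor_mem_trans (fun h => hjmin i (by omega) (Or.inr h)) (ih (by omega))
        (hmem (hpa i (by omega)))
  -- `q 0, …, q x, p 0, …, p (j - 1), q (x + 1), …, q (x + z + 1), p j, …, p y`
  let v : ℕ → Fin n := fun t =>
    if t ≤ x then q t else if t ≤ x + j then p (t - x - 1)
    else if t ≤ x + j + z + 1 then q (t - j) else p (t - x - z - 2)
  refine ⟨v, ?_, ?_⟩
  · intro s t hs ht h
    simp only [v] at h
    split_ifs at h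
    all_goals first
      | (have := hp _ _ (by omega) (by omega) h; omega)
      | (have := hq _ _ (by omega) (by omega) h; omega)
      | exact absurd h (hpq _ _ (by omega) (by omega))
      | exact absurd h.symm (hpq _ _ (by omega) (by omega))
  · intro t ht
    rw [Finset.mem_range] at ht
    have h1 : ∀ t ≤ x, v t = q t := fun t h => if_pos h
    have h2 : ∀ t, x < t → t ≤ x + j → v t = p (t - x - 1) := fun t h h' => by
      simp only [v]; rw [if_neg (by omega), if_pos h']
    have h3 : ∀ t, x + j < t → t ≤ x + j + z + 1 → v t = q (t - j) := fun t h h' => by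
      simp only [v]; rw [if_neg (by omega), if_neg (by omega), if_pos h']
    have h4 : ∀ t, x + j + z + 1 < t → v t = p (t - x - z - 2) := fun t h => by
      simp only [v]; rw [if_neg (by omega), if_neg (by omega), if_neg (by omega)]
    rcases lt_trichotomy t x with htx | rfl | htx
    · rw [h1 t htx.le, h1 (t + 1) htx]
      exact hmem (hqa t (by omega))
    · rw [h1 t le_rfl]
      rcases Nat.eq_zero_or_pos j with rfl | hj0
      · rw [h3 (t + 1) (by omega) (by omega)]
        exact hmem (hqa t (by omega))
      · rw [h2 (t + 1) (by omega) (by omega), show t + 1 - t - 1 = 0 by omega]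
        exact hmem hpx.symm
    rcases lt_trichotomy t (x + j) with htj | rfl | htj
    · rw [h2 t htx htj.le, h2 (t + 1) (by omega) htj,
        show t + 1 - x - 1 = t - x - 1 + 1 by omega]
      exact hmem (hpa _ (by omega))
    · rw [h2 _ htx le_rfl, h3 _ (by omega) (by omega), show x + j + 1 - j = x + 1 by omega]
      exact colMinor_mem_comm.1 (hprop _ (by omega))
    rcases lt_trichotomy t (x + j + z + 1) with htz | rfl | htz
    · rw [h3 t htj htz.le, h3 (t + 1) (by omega) htz, show t + 1 - j = t - j + 1 by omega]
      exact hmem (hqa _ (by omega))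
    · rw [h4 (x + j + z + 1 + 1) (by omega), show x + j + z + 1 + 1 - x - z - 2 = j by omega]
      have hj' := hj.resolve_left (by omega)
      exact colMinor_mem_comm.1 (colMinor_mem_of_col_mem hj'.1 hj'.2 _)
    · rw [h4 t htz, h4 (t + 1) (by omega), show t + 1 - x - z - 2 = t - x - z - 2 + 1 by omega]
      exact hmem (hpa _ (by omega))

end LowerBounds

/-! ### Edge counts -/

section EdgeCounts

open SimpleGraph

/-- A graph has at most as many edges as vertices if it can be oriented with all out-degrees at most
one. -/
lemma ncard_edgeSet_le_of_orientation {V : Type*} [Finite V] {G : SimpleGraph V} (f : V → V)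
    (h : ∀ x y, G.Adj x y → y = f x ∨ x = f y) : G.edgeSet.ncard ≤ Nat.card V := by
  have hsub : G.edgeSet ⊆ (fun x => s(x, f x)) '' Set.univ := by
    intro e he
    induction e with
    | h x y =>
      rcases h x y he with rfl | rfl
      · exact ⟨x, trivial, rfl⟩
      · exact ⟨y, trivial, Sym2.eq_swap⟩
  calc _ ≤ _ := Set.ncard_le_ncard hsub (Set.toFinite _)
    _ ≤ _ := Set.ncard_image_le Set.finite_univ
    _ = _ := Set.ncard_univ V

lemma ncard_edgeSet_iso {V W : Type*} {G : SimpleGraph V} {H : SimpleGraph W} (e : G ≃g H) :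
    G.edgeSet.ncard = H.edgeSet.ncard := by
  rw [← Nat.card_coe_set_eq, ← Nat.card_coe_set_eq]
  exact Nat.card_congr e.mapEdgeSet

lemma ncard_edgeSet_le_of_isPathPlusEdge {V : Type*} {G : SimpleGraph V}
    (h : IsPathPlusEdge G) : G.edgeSet.ncard ≤ Nat.card V := by
  classical
  obtain ⟨a, u, v, -, -, ⟨e⟩⟩ := h
  rw [ncard_edgeSet_iso e, Nat.card_congr e.toEquiv]
  -- the path is oriented towards `u`, and the additional edge away from it
  refine ncard_edgeSet_le_of_orientation (fun x => if h : x = u then v else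
    if h' : x < u then ⟨x + 1, by omega⟩ else ⟨x - 1, by omega⟩) fun x y hxy => ?_
  rw [sup_adj, pathGraph_adj, edge_adj] at hxy
  rcases hxy with hxy | ⟨⟨rfl, rfl⟩ | ⟨rfl, rfl⟩, -⟩
  · split_ifs <;> simp only [Fin.ext_iff] at * <;> omega
  · simp
  · simp

lemma ncard_edgeSet_le_of_isTriangleWithPaths {V : Type*} {G : SimpleGraph V}
    (h : IsTriangleWithPaths G) : G.edgeSet.ncard ≤ Nat.card V := by
  classical
  obtain ⟨ℓ, -, ⟨e⟩⟩ := h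
  rw [ncard_edgeSet_iso e, Nat.card_congr e.toEquiv]
  -- the attached paths are oriented towards the triangle, which is oriented cyclically
  refine ncard_edgeSet_le_of_orientation (fun x => if (x.2 : ℕ) = 0 then ⟨x.1 + 1, 0⟩ else
    ⟨x.1, ⟨x.2 - 1, by omega⟩⟩) ?_
  rintro ⟨i, k⟩ ⟨j, l⟩ (⟨hij, h⟩ | ⟨hij, hk, hl⟩)
  · obtain rfl : i = j := hij
    simp only at h
    rcases h with h | h
    · right
      rw [if_neg (by simp only; omega)]
      simp only [Sigma.mk.injEq, heq_eq_eq, true_and, Fin.ext_iff]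
      omega
    · left
      rw [if_neg (by simp only; omega)]
      simp only [Sigma.mk.injEq, heq_eq_eq, true_and, Fin.ext_iff]
      omega
  · simp only at hij hk hl
    obtain rfl : k = 0 := Fin.ext hk
    obtain rfl : l = 0 := Fin.ext hl
    simp only [Fin.val_zero, if_true]
    have key : ∀ i j : Fin 3, i ≠ j → j = i + 1 ∨ i = j + 1 := by decide
    rcases key i j hij with rfl | rfl
    · exact Or.inl rfl
    · exact Or.inr rfl

lemma exists_two_le_degree {n : ℕ} {G : SimpleGraph (Fin n)} (hn : 3 ≤ n) (hG : G.Connected) :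
    ∃ v, 2 ≤ (G.neighborSet v).ncard := by
  classical
  by_contra! h
  have hsum := G.sum_degrees_eq_twice_card_edges
  have hle : ∑ v, G.degree v ≤ ∑ _v : Fin n, 1 := Finset.sum_le_sum fun v _ => by
    have := h v
    rw [← G.card_neighborSet_eq_degree, ← Nat.card_eq_fintype_card, Nat.card_coe_set_eq]
    omega
  have hcard := hG.card_vert_le_card_edgeSet_add_one
  rw [Nat.card_eq_fintype_card (α := G.edgeSet), ← edgeFinset_card, Nat.card_fin] at hcard
  simp at hle
  omega

end EdgeCounts

/-! ### Almost complete intersections -/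

section Main

open SimpleGraph

variable {K : Type*} [Field K] {n : ℕ} {G : SimpleGraph (Fin n)}

lemma isAlmostCompleteIntersection_iff {m : ℕ} :
    IsAlmostCompleteIntersection (genBinomialEdgeIdeal K m G) ↔
      ((m.choose 2 * G.edgeSet.ncard : ℕ) : ℕ∞) = (genBinomialEdgeIdeal K m G).height + 1 := by
  rw [IsAlmostCompleteIntersection, spanFinrank_genBinomialEdgeIdeal]

/-- For at least three rows, isolating a vertex of degree at least two gives a bound on the height
which is too small. -/
lemma eq_two_of_isAlmostCompleteIntersection {m : ℕ} (hm : 2 ≤ m) (hn : 3 ≤ n) (hG : G.Connected)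
    (h : IsAlmostCompleteIntersection (genBinomialEdgeIdeal K m G)) : m = 2 := by
  by_contra hm2
  obtain ⟨v, hv⟩ := exists_two_le_degree hn hG
  have h1 := ncard_edgeSet_isolate (G := G) v
  have h2 := height_le_of_vertex K m G v
  rw [isAlmostCompleteIntersection_iff] at h
  have h3 : ((m.choose 2 * G.edgeSet.ncard : ℕ) : ℕ∞) ≤
      ((m + m.choose 2 * (isolate G v).edgeSet.ncard + 1 : ℕ) : ℕ∞) := by
    rw [h]
    push_cast at h2 ⊢
    exact add_le_add_left h2 1
  have h4 : m.choose 2 * G.edgeSet.ncard ≤ m + m.choose 2 * (isolate G v).edgeSet.ncard + 1 := by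
    exact_mod_cast h3
  have h5 : m ≤ m.choose 2 := by
    rw [Nat.choose_two_right, Nat.le_div_iff_mul_le two_pos]
    exact Nat.mul_le_mul_left m (by omega)
  have h6 : m.choose 2 * (isolate G v).edgeSet.ncard + m.choose 2 * 2 ≤
      m.choose 2 * G.edgeSet.ncard := by
    rw [← mul_add]
    exact Nat.mul_le_mul_left _ (by omega)
  omega

/-- The combinatorial consequences of the height bounds. -/
lemma classification_of_isAlmostCompleteIntersection (hn : 3 ≤ n) (hG : G.Connected)
    (h : IsAlmostCompleteIntersection (genBinomialEdgeIdeal K 2 G)) :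
    (G.IsTree ∧ ¬ IsPathGraph G ∧ IsTwoPathsPlusEdge G) ∨
      (¬ G.IsTree ∧ (IsPathPlusEdge G ∨ IsTriangleWithPaths G)) := by
  rw [isAlmostCompleteIntersection_iff, Nat.choose_self, one_mul] at h
  have hV : Nat.card (Fin n) = n := Nat.card_fin n
  have hle := height_le_of_connected K hG
  obtain ⟨k, hk⟩ : ∃ k : ℕ, (genBinomialEdgeIdeal K 2 G).height = k :=
    ENat.ne_top_iff_exists.1 (fun ht => by simp [ht] at hle) |>.imp fun _ h => h.symm
  have hvert := fun v => height_le_of_vertex K 2 G v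
  have hpair := fun (v w : Fin n) (hvw : v ≠ w) (h : ¬ G.Adj v w) =>
    height_le_of_two_vertices K hvw h
  have hcycle := fun (v x : Fin n) (w : G.Walk x x) (hw : w.IsCycle) (hv : v ∉ w.support) =>
    height_le_of_cycle K hw hv
  have hpath := fun (h : IsPathGraph G) => le_height_of_isPathGraph K (by omega) h
  rw [hk] at h hle hpath
  simp only [hk] at hvert hpair hcycle
  norm_cast at h hle hpath hvert hpair hcycle
  simp only [Nat.choose_self] at hvert
  have hE := hG.card_vert_le_card_edgeSet_add_one
  rw [Nat.card_coe_set_eq, hV] at hE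
  have h3 : ∀ x, (G.neighborSet x).ncard ≤ 3 := by
    intro x
    have h1 := hvert x
    have h2 := ncard_edgeSet_isolate (G := G) x
    omega
  have hadj : ∀ x y, x ≠ y → 3 ≤ (G.neighborSet x).ncard → 3 ≤ (G.neighborSet y).ncard →
      G.Adj x y := by
    intro x y hxy hx hy
    by_contra hnot
    have := hpair x y hxy hnot
    omega
  have htree := isTree_iff_connected_and_card (G := G)
  rw [Nat.card_coe_set_eq, hV] at htree
  by_cases hT : G.IsTree
  · have hcard := (htree.1 hT).2
    have hnp : ¬ IsPathGraph G := fun hp => by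
      have := hpath hp
      omega
    exact Or.inl ⟨hT, hnp, isTwoPathsPlusEdge_of_isTree hT h3 hadj hnp⟩
  · have hcard : G.edgeSet.ncard = n := by
      have : G.edgeSet.ncard + 1 ≠ n := fun h => hT (htree.2 ⟨hG, h⟩)
      omega
    refine Or.inr ⟨hT, isPathPlusEdge_or_isTriangleWithPaths hG (hcard.trans hV.symm) h3 hadj ?_⟩
    intro x hx y w hw
    by_contra hnot
    have := hcycle x y w hw hnot
    omega

lemma isAlmostCompleteIntersection_of_isTree (hn : 3 ≤ n) (hT : G.IsTree) (hp : ¬ IsPathGraph G)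
    (h : IsTwoPathsPlusEdge G) : IsAlmostCompleteIntersection (genBinomialEdgeIdeal K 2 G) := by
  rw [isAlmostCompleteIntersection_iff, Nat.choose_self, one_mul]
  have hcard := (isTree_iff_connected_and_card.1 hT).2
  rw [Nat.card_coe_set_eq, Nat.card_fin] at hcard
  obtain ⟨v, hv⟩ := exists_three_le_of_not_isPathGraph hT hp
  have h1 := height_le_of_vertex K 2 G v
  have h2 := ncard_edgeSet_isolate (G := G) v
  have h3 : (genBinomialEdgeIdeal K 2 G).height = ((n - 2 : ℕ) : ℕ∞) := by
    refine le_antisymm (h1.trans ?_) (le_height_of_isTwoPathsPlusEdge K (by omega) h)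
    rw [Nat.choose_self]
    exact_mod_cast by omega
  rw [h3]
  exact_mod_cast by omega

lemma isAlmostCompleteIntersection_of_not_isTree (hn : 3 ≤ n) (hG : G.Connected)
    (hT : ¬ G.IsTree) (h : IsPathPlusEdge G ∨ IsTriangleWithPaths G) :
    IsAlmostCompleteIntersection (genBinomialEdgeIdeal K 2 G) := by
  rw [isAlmostCompleteIntersection_iff, Nat.choose_self, one_mul]
  have hE := hG.card_vert_le_card_edgeSet_add_one
  have htree := isTree_iff_connected_and_card (G := G)
  rw [Nat.card_coe_set_eq, Nat.card_fin] at hE htree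
  have hne : G.edgeSet.ncard + 1 ≠ n := fun h => hT (htree.2 ⟨hG, h⟩)
  have hle : G.edgeSet.ncard ≤ n := by
    have := h.elim ncard_edgeSet_le_of_isPathPlusEdge ncard_edgeSet_le_of_isTriangleWithPaths
    rwa [Nat.card_fin] at this
  have h1 : ((n - 1 : ℕ) : ℕ∞) ≤ (genBinomialEdgeIdeal K 2 G).height :=
    h.elim (le_height_of_isPathPlusEdge K (by omega))
      (le_height_of_isTriangleWithPaths K (by omega))
  rw [show G.edgeSet.ncard = n by omega]
  refine le_antisymm ?_ (height_le_of_connected K hG)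
  calc (n : ℕ∞) = ((n - 1 : ℕ) : ℕ∞) + 1 := by exact_mod_cast by omega
    _ ≤ _ := add_le_add_left h1 1

end Main

end

theorem mainTheorem12 (K : Type*) [Field K] (m n : ℕ) (hm : 2 ≤ m) (hn : 3 ≤ n)
    (G : SimpleGraph (Fin n)) (hG : G.Connected) :
    IsAlmostCompleteIntersection (genBinomialEdgeIdeal K m G) ↔
      m = 2 ∧
        ((G.IsTree ∧ ¬ IsPathGraph G ∧ IsTwoPathsPlusEdge G) ∨
          (¬ G.IsTree ∧ (IsPathPlusEdge G ∨ IsTriangleWithPaths G))) := by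
  constructor
  · intro h
    obtain rfl := eq_two_of_isAlmostCompleteIntersection hm hn hG h
    exact ⟨rfl, classification_of_isAlmostCompleteIntersection hn hG h⟩
  · rintro ⟨rfl, ⟨hT, hp, h⟩ | ⟨hT, h⟩⟩
    · exact isAlmostCompleteIntersection_of_isTree hn hT hp h
    · exact isAlmostCompleteIntersection_of_not_isTree hn hG hT h
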